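/- Let $\Sigma$ be a finite alphabet and $\mathbb{T}\Sigma^*$ the set of timed words $(t_1\cdot a_1)\cdots(t_n\cdot a_n)$ with $t_i\in\mathbb{R}_{\ge 0}$, $a_i\in\Sigma$. For $L\subseteq \mathbb{T}\Sigma^*$ write $u^{-1}L=\{w\mid uw\in L\}$. **Automata.** A 1-DTA is a deterministic one-clock timed automaton: finitely many states, finitely many transitions $(q,q',a,\phi,r)$ whose guard $\phi$ is a conjunction of constraints $c<x$, $x=c$, $x<c$ with $c\in\mathbb{N}$ and where $r\in\{0,1\}$ ($r=0$: the clock is reset, $r=1$: it is kept), distinct transitions with the same source and letter having disjoint guards. Its maximum constant is the largest constant in its guards ($0$ if it has no transition). It is complete if every timed word has exactly one run from the initial configuration (initial state, clock value $0$); its reset function then maps $u$ to the clock value at the end of the run on $u$. $L$ is 1-DTA recognizable if it is the language of some 1-DTA; then $K_L$ denotes the least maximum constant of a 1-DTA with language $L$. **Acceptors.** Write $y\equiv z$ if $\lfloor y\rfloor=\lfloor z\rfloor$ and ($y\in\mathbb{N}\Leftrightarrow z\in\mathbb{N}$). A $K$-region is a class of the equivalence $y\equiv^K z\iff (y\equiv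 z)\lor(y>K\land z>K)$ on $\mathbb{R}_{\ge0}$. A $K$-acceptor is a complete 1-DTA with maximum constant $K$, all of whose guards define $K$-regions, together with a $K$-region $\mathit{region}(q)$ for each state $q$, such that each run from the initial configuration that ends in $q$ ends with a clock value in $\mathit{region}(q)$. It is strict if every transition whose guard defines a set $\{n\}$, $n\in\mathbb{N}$, resets the clock. **Canonical acceptor.** Define $\mathbf{R}^L:\mathbb{T}\Sigma^*\to\mathbb{R}_{\ge0}$ by $\mathbf{R}^L(\epsilon)=0$, and $\mathbf{R}^L(u(t\cdot a))=0$ if $(u(t\cdot a))^{-1}L$ is 1-DTA recognizable, $\mathbf{R}^L(u(t\cdot a))=\mathbf{R}^L(u)+t$ otherwise. Let $\mathcal{HI}$ be the set of timed words all of whose delays are in $\frac12\mathbb{N}$, and for $u,v\in\mathcal{HI}$ let $u\approx^L v$ iff $\mathbf{R}^L(u)=\mathbf{R}^L(v)$ and $u^{-1}L=v^{-1}L$. Let $K\in\mathbb{N}\cup\{\infty\}$ be the infimum of the $k\in\mathbb{N}$ such that, for all $u\in\mathcal{HI}$, $a\in\Sigma$, $n\in\mathbb{N}$, $\mathbf{R}^L(u)+\frac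 n2>k$ implies $u(\frac n2\cdot a)\approx^L u(k+\frac12\cdot a)$ (with $K=\infty$ if there is no such $k$). For $t\ge0$ let $\phi_K(t)$ be $x=t$ if $t\le K$ and $t\in\mathbb{N}$; $\lfloor t\rfloor<x<\lceil t\rceil$ if $t\le K$ and $t\notin\mathbb{N}$; and $K<x$ if $t>K$. The automaton $\mathcal{A}_{(\mathbf{R}^L,\approx^L)}$ has as states the classes $[u]$ of $\approx^L$ ($u\in\mathcal{HI}$), initial state $[\epsilon]$, final states $[u]$ with $u\in L\cap\mathcal{HI}$, and the transitions $([u],[v],a,\phi_K(\mathbf{R}^L(u)+\frac n2),s)$ for $u,v\in\mathcal{HI}$, $a\in\Sigma$, $n\in\mathbb{N}$ with $u(\frac n2\cdot a)\approx^L v$, where $s=0$ if $\mathbf{R}^L(v)=0$ and $s=1$ otherwise. **Proposition.** Let $L\subseteq\mathbb{T}\Sigma^*$ be 1-DTA recognizable. 1. $\mathcal{A}_{(\mathbf{R}^L,\approx^L)}$ is a strict $K_L$-acceptor (in particular it is finite) with language $L$ and reset function $\mathbf{R}^L$. Its regions can moreover be chosen so that for every state $q$: if some transition into $q$ resets the clock,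 then every transition into $q$ does and $\mathit{region}(q)=\{0\}$; otherwise the guard of every transition into $q$ defines $\mathit{region}(q)$. 2. Every strict acceptor (that is, strict $K$-acceptor for any $K\in\mathbb{N}$) with language $L$ has at least as many states as $\mathcal{A}_{(\mathbf{R}^L,\approx^L)}$. -/

import Mathlib

open scoped NNReal ENNReal

namespace OneClock

/-- Timed words `(t₁·a₁) ⋯ (tₙ·aₙ)`: finite sequences of pairs (delay, letter). -/
abbrev TimedWord (α : Type*) := List (ℝ≥0 × α)

/-- Timed languages. -/
abbrev TimedLanguage (α : Type*) := Set (TimedWord α)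

/-- The residual language `u⁻¹L`. -/
def residual {α : Type*} (u : TimedWord α) (L : TimedLanguage α) : TimedLanguage α :=
  {w | u ++ w ∈ L}

/-! ### One-clock timed automata -/

/-- Clock constraints `c < x`, `x = c`, `x < c`, `φ ∧ ψ`. -/
inductive Constraint where
  | gt (c : ℕ) : Constraint
  | eq (c : ℕ) : Constraint
  | lt (c : ℕ) : Constraint
  | and (φ ψ : Constraint) : Constraint

/-- The set `⟦φ⟧` of clock values satisfying a constraint. -/
def Constraint.sat : Constraint → Set ℝ≥0
  | .gt c => {x | (c : ℝ≥0) < x}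
  | .eq c => {x | x = (c : ℝ≥0)}
  | .lt c => {x | x < (c : ℝ≥0)}
  | .and φ ψ => φ.sat ∩ ψ.sat

/-- The largest constant occurring in a constraint. -/
def Constraint.maxConst : Constraint → ℕ
  | .gt c => c
  | .eq c => c
  | .lt c => c
  | .and φ ψ => max φ.maxConst ψ.maxConst

/-- Transitions `(q, q', a, φ, r)`; `reset = true` is the value `r = 0` (the clock is reset),
`reset = false` is the value `r = 1` (the clock is kept). -/
structure Transition (α Q : Type*) where
  src : Q
  tgt : Q
  letter : α
  guard : Constraint
  reset : Bool

/-- The data of a one-clock automaton. Finiteness of the sets of states and of transitions is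
part of `OneTA.IsDTA` below. -/
structure OneTA (α Q : Type*) where
  init : Q
  trans : Set (Transition α Q)
  accept : Set Q

namespace OneTA

variable {α Q : Type*}

/-- `A.Run c w e c'`: the sequence `e` of transitions is a run of `A` on `w` from the
configuration `c` to the configuration `c'`. -/
inductive Run (A : OneTA α Q) :
    Q × ℝ≥0 → TimedWord α → List (Transition α Q) → Q × ℝ≥0 → Prop
  | nil (c : Q × ℝ≥0) : Run A c [] [] c
  | cons (θ : Transition α Q) (ν t : ℝ≥0) (w : TimedWord α) (e : List (Transition α Q))
      (c' : Q × ℝ≥0) (hθ : θ ∈ A.trans) (hg : ν + t ∈ θ.guard.sat)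
      (hrun : Run A (θ.tgt, if θ.reset then 0 else ν + t) w e c') :
      Run A (θ.src, ν) ((t, θ.letter) :: w) (θ :: e) c'

/-- `c ⇝ʷ c'`. -/
def Reaches (A : OneTA α Q) (c : Q × ℝ≥0) (w : TimedWord α) (c' : Q × ℝ≥0) : Prop :=
  ∃ e, A.Run c w e c'

/-- The language `𝓛(A)`. -/
def language (A : OneTA α Q) : TimedLanguage α :=
  {w | ∃ q ν, q ∈ A.accept ∧ A.Reaches (A.init, 0) w (q, ν)}

/-- Distinct transitions with the same source and letter have disjoint guards. -/
def Deterministic (A : OneTA α Q) : Prop :=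
  ∀ θ ∈ A.trans, ∀ θ' ∈ A.trans, θ ≠ θ' →
    θ.src ≠ θ'.src ∨ θ.letter ≠ θ'.letter ∨ Disjoint θ.guard.sat θ'.guard.sat

/-- `A` is a `1`-DTA. -/
structure IsDTA (A : OneTA α Q) : Prop where
  finite_states : Finite Q
  finite_trans : A.trans.Finite
  deterministic : A.Deterministic

/-- Every timed word has exactly one run from the initial configuration. -/
def Complete (A : OneTA α Q) : Prop :=
  ∀ w : TimedWord α, ∃! e : List (Transition α Q), ∃ c, A.Run (A.init, 0) w e c

/-- `K` is the largest constant in the transitions of `A` (`0` if there is no transition). -/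
def HasMaxConst (A : OneTA α Q) (K : ℕ) : Prop :=
  IsLUB {c | ∃ θ ∈ A.trans, c = θ.guard.maxConst} K

/-- For complete deterministic `A`: the reset function `R^A` induced by `A` is `R`, that is,
the run of `A` on each word `u` ends with clock value `R u`. -/
def HasResetFunction (A : OneTA α Q) (R : TimedWord α → ℝ≥0) : Prop :=
  ∀ u, ∃ q, A.Reaches (A.init, 0) u (q, R u)

end OneTA

/-- `L` is `1`-DTA recognizable. -/
def Recognizable {α : Type*} (L : TimedLanguage α) : Prop :=
  ∃ (Q : Type) (A : OneTA α Q), A.IsDTA ∧ A.language = L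

/-- `K_L`: the smallest `K` such that some `1`-DTA with maximum constant `K` accepts `L`
(meant for recognizable `L`, where such a `K` exists). -/
noncomputable def languageConst {α : Type*} (L : TimedLanguage α) : ℕ :=
  sInf {K | ∃ (Q : Type) (A : OneTA α Q), A.IsDTA ∧ A.HasMaxConst K ∧ A.language = L}

/-! ### Regions and acceptors -/

/-- `y ≡ z`: same integral part, and the fractional parts are both zero or both nonzero. -/
def RegionEq (y z : ℝ≥0) : Prop :=
  ⌊y⌋₊ = ⌊z⌋₊ ∧ ((⌊y⌋₊ : ℝ≥0) = y ↔ (⌊z⌋₊ : ℝ≥0) = z)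

/-- `y ≡ᴷ z`. -/
def RegionEqUpTo (K : ℕ) (y z : ℝ≥0) : Prop :=
  RegionEq y z ∨ ((K : ℝ≥0) < y ∧ (K : ℝ≥0) < z)

/-- `S` is a `K`-region, i.e. a class of `≡ᴷ`. -/
def IsRegion (K : ℕ) (S : Set ℝ≥0) : Prop :=
  ∃ y, S = {z | RegionEqUpTo K y z}

namespace OneTA

variable {α Q : Type*}

/-- `region` assigns to every state a `K`-region that contains the clock value of every run
ending in that state. -/
def IsRegionAssignment (A : OneTA α Q) (K : ℕ) (region : Q → Set ℝ≥0) : Prop :=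
  (∀ q, IsRegion K (region q)) ∧
    ∀ u q ν, A.Reaches (A.init, 0) u (q, ν) → ν ∈ region q

/-- The syntactic form of the condition on regions: if some transition into `q` resets, then all
transitions into `q` reset and the region of `q` is `{0}`; otherwise the guard of every transition
into `q` defines the region of `q`. -/
def IsSyntacticRegionAssignment (A : OneTA α Q) (region : Q → Set ℝ≥0) : Prop :=
  ∀ q,
    ((∃ θ ∈ A.trans, θ.tgt = q ∧ θ.reset = true) →
      (∀ θ ∈ A.trans, θ.tgt = q → θ.reset = true) ∧ region q = {0}) ∧
    ((¬ ∃ θ ∈ A.trans, θ.tgt = q ∧ θ.reset = true) →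
      ∀ θ ∈ A.trans, θ.tgt = q → θ.guard.sat = region q)

/-- `K`-acceptors: complete `1`-DTAs with maximum constant `K`, all of whose guards define
`K`-regions, with a `K`-region attached to every state. -/
structure IsAcceptor (A : OneTA α Q) (K : ℕ) : Prop where
  isDTA : A.IsDTA
  complete : A.Complete
  maxConst : A.HasMaxConst K
  guard_region : ∀ θ ∈ A.trans, IsRegion K θ.guard.sat
  region : ∃ region : Q → Set ℝ≥0, A.IsRegionAssignment K region

/-- Strict `K`-acceptors: every transition with an equality guard `x = n` resets the clock. -/
structure IsStrictAcceptor (A : OneTA α Q) (K : ℕ) : Prop where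
  isAcceptor : A.IsAcceptor K
  strict : ∀ θ ∈ A.trans, ∀ n : ℕ, θ.guard.sat = {(n : ℝ≥0)} → θ.reset = true

end OneTA

/-! ### Reset functions -/

/-- Reset functions `R`: `R(ε) = 0`, and `R(u(t·a))` is `0` or `R(u) + t`. -/
structure ResetFunction (α : Type*) where
  toFun : TimedWord α → ℝ≥0
  map_nil : toFun [] = 0
  map_concat : ∀ u t a, toFun (u ++ [(t, a)]) = 0 ∨ toFun (u ++ [(t, a)]) = toFun u + t

open Classical in
/-- The values of the syntactic reset function `R^L`, by recursion on the last letter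
(see `synResetVal_nil` and `synResetVal_concat`). -/
noncomputable def synResetVal {α : Type*} (L : TimedLanguage α) (u : TimedWord α) : ℝ≥0 :=
  List.reverseRecOn u 0 fun v p r => if Recognizable (residual (v ++ [p]) L) then 0 else r + p.1

theorem synResetVal_nil {α : Type*} (L : TimedLanguage α) : synResetVal L [] = 0 := by
  simp [synResetVal]

open Classical in
theorem synResetVal_concat {α : Type*} (L : TimedLanguage α) (u : TimedWord α) (t : ℝ≥0) (a : α) :
    synResetVal L (u ++ [(t, a)]) =
      if Recognizable (residual (u ++ [(t, a)]) L) then 0 else synResetVal L u + t := by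
  simp [synResetVal]

/-- The syntactic reset function `R^L`. -/
noncomputable def synReset {α : Type*} (L : TimedLanguage α) : ResetFunction α where
  toFun := synResetVal L
  map_nil := synResetVal_nil L
  map_concat u t a := by
    rw [synResetVal_concat]
    split_ifs
    · exact Or.inl rfl
    · exact Or.inr rfl

/-! ### Half-integral words and profiles -/

/-- The set of half-integral words: all delays are of the form `m / 2`. -/
def HI (α : Type*) : Type _ :=
  {w : TimedWord α // ∀ p ∈ w, ∃ m : ℕ, p.1 = (m : ℝ≥0) / 2}

namespace HI

variable {α : Type*}

/-- The empty word. -/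
def nil : HI α := ⟨[], by simp⟩

/-- The half-integral word `u (n/2 · a)`. -/
noncomputable def concat (u : HI α) (n : ℕ) (a : α) : HI α :=
  ⟨u.1 ++ [((n : ℝ≥0) / 2, a)], by
    intro p hp
    rcases List.mem_append.1 hp with h | h
    · exact u.2 p h
    · rw [List.mem_singleton] at h
      exact ⟨n, by rw [h]⟩⟩

end HI

/-- Profiles `(R, ≈)`. -/
structure Profile (α : Type*) where
  R : ResetFunction α
  rel : Setoid (HI α)

namespace Profile

variable {α : Type*}

/-- The proposition `C(K)`; note that `K + 1/2 = (2K + 1)/2`. -/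
def C (P : Profile α) (K : ℕ) : Prop :=
  ∀ (u : HI α) (a : α) (n : ℕ), (K : ℝ≥0) < P.R.toFun u.1 + (n : ℝ≥0) / 2 →
    P.rel.r (u.concat n a) (u.concat (2 * K + 1) a)

/-- `K_(R,≈) = inf {K | C(K)}` in `ℕ ∪ {∞}`, with value `∞` if there is no such `K`. -/
noncomputable def const (P : Profile α) : ℕ∞ :=
  sInf {k | ∃ K : ℕ, P.C K ∧ k = (K : ℕ∞)}

end Profile

open Classical in
/-- The clock constraint `φ_K(t)`. The last case occurs only for finite `K`. -/
noncomputable def phi (K : ℕ∞) (t : ℝ≥0) : Constraint :=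
  if (t : ℝ≥0∞) ≤ (K : ℝ≥0∞) then
    if (⌊t⌋₊ : ℝ≥0) = t then .eq ⌊t⌋₊ else .and (.gt ⌊t⌋₊) (.lt ⌈t⌉₊)
  else .gt K.toNat

open Classical in
/-- The automaton `A_(R,≈)` (for the language `L`), whose states are the classes of `≈`. -/
noncomputable def Profile.automaton {α : Type*} (P : Profile α) (L : TimedLanguage α) :
    OneTA α (Quotient P.rel) where
  init := Quotient.mk P.rel HI.nil
  trans := {θ | ∃ (u v : HI α) (a : α) (n : ℕ), P.rel.r (u.concat n a) v ∧
    θ = { src := Quotient.mk P.rel u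
          tgt := Quotient.mk P.rel v
          letter := a
          guard := phi P.const (P.R.toFun u.1 + (n : ℝ≥0) / 2)
          reset := decide (P.R.toFun v.1 = 0) }}
  accept := {q | ∃ u : HI α, u.1 ∈ L ∧ q = Quotient.mk P.rel u}

/-- The equivalence `≈^L`. -/
def synRel {α : Type*} (L : TimedLanguage α) : Setoid (HI α) where
  r u v := (synReset L).toFun u.1 = (synReset L).toFun v.1 ∧ residual u.1 L = residual v.1 L
  iseqv :=
    { refl := fun _ => ⟨rfl, rfl⟩
      symm := fun h => ⟨h.1.symm, h.2.symm⟩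
      trans := fun h h' => ⟨h.1.trans h'.1, h.2.trans h'.2⟩ }

/-- The syntactic profile `(R^L, ≈^L)`. -/
noncomputable def synProfile {α : Type*} (L : TimedLanguage α) : Profile α where
  R := synReset L
  rel := synRel L

/-- The states of the canonical acceptor: the classes of `≈^L`. -/
abbrev CanonicalState {α : Type*} (L : TimedLanguage α) : Type _ :=
  Quotient (synProfile L).rel

/-- The canonical acceptor `A_(R^L,≈^L)`. -/
noncomputable def canonicalAcceptor {α : Type*} (L : TimedLanguage α) :
    OneTA α (CanonicalState L) :=
  (synProfile L).automaton L

end OneClock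

/-!
The half-integers represent the regions, and everything rests on one fact about rescaling time: a
strictly increasing map `f` that commutes with the translation by `1` carries a run to a run through
the same states, since a guard only depends on the region of a clock value. If `x` and `y` are
region equivalent, some such `f` fixes `0` and sends `x` to `y`, so rescaling by `f` carries the
language accepted by an automaton from `(q, x)` to the one accepted from `(q, y)`. If the latter is
recognizable, it is accepted by an automaton that starts with clock value `0 = f 0`, hence is itself
invariant under `f`, and the two languages coincide.

Consequently, as long as two words are read so that the values of `R^L` stay region equivalent,
their residuals are recognizable at the same time and then equal, and otherwise belong to a common
family indexed by the value of `R^L`. Thus `A_(R^L,≈^L)` follows an arbitrary timed word along a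
half-integral one.

For minimality, consider a half-integral word whose residual is not recognizable. A strict acceptor
ends on it with a clock value at most `K` that is not a natural number, and the value of `R^L` is
not a natural number either. Neither has been reset since the last prefix with recognizable
residual, where `R^L` vanishes. After the next letter `R^L` equals the delay `d` and the clock is
`ν + d`, where `ν` is the clock value at that prefix. As `d` and `ν + d` are half-integers but not
integers, `ν` is a natural number at most `K`, so strictness forces `ν = 0`. Hence the clock agrees
with `R^L` on such words, and words that reach the same state are equivalent.
-/

namespace OneClock

/-! ### Regions -/

section Regions

variable {K : ℕ} {x y z : ℝ≥0}

/-- The position of the region of `x` in the list `{0}, (0, 1), {1}, (1, 2), …`, counted from `0`.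
It encodes region equivalence in linear arithmetic over `ℕ`. -/
noncomputable def regionIndex (x : ℝ≥0) : ℕ := ⌊x⌋₊ + ⌈x⌉₊

theorem regionIndex_mono : Monotone regionIndex := fun _ _ h =>
  add_le_add (Nat.floor_mono h) (Nat.ceil_mono h)

theorem regionIndex_add_natCast (x : ℝ≥0) (n : ℕ) :
    regionIndex (x + n) = regionIndex x + 2 * n := by
  rw [regionIndex, regionIndex, Nat.floor_add_natCast zero_le, Nat.ceil_add_natCast zero_le]
  ring

theorem floor_eq_regionIndex_div_two (x : ℝ≥0) : ⌊x⌋₊ = regionIndex x / 2 := by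
  have h₁ := Nat.floor_le_ceil x
  have h₂ := Nat.ceil_le_floor_add_one x
  unfold regionIndex
  omega

theorem ceil_eq_regionIndex_add_one_div_two (x : ℝ≥0) : ⌈x⌉₊ = (regionIndex x + 1) / 2 := by
  have h := floor_eq_regionIndex_div_two x
  unfold regionIndex at h ⊢
  omega

theorem natCast_lt_iff_regionIndex {c : ℕ} : (c : ℝ≥0) < x ↔ 2 * c < regionIndex x := by
  rw [← Nat.lt_ceil, ceil_eq_regionIndex_add_one_div_two]
  omega

theorem lt_natCast_iff_regionIndex {c : ℕ} : x < (c : ℝ≥0) ↔ regionIndex x < 2 * c := by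
  rw [← Nat.floor_lt zero_le, floor_eq_regionIndex_div_two]
  omega

theorem le_natCast_iff_regionIndex {c : ℕ} : x ≤ (c : ℝ≥0) ↔ regionIndex x ≤ 2 * c := by
  rw [← not_lt, natCast_lt_iff_regionIndex, not_lt]

theorem eq_natCast_iff_regionIndex {c : ℕ} : x = (c : ℝ≥0) ↔ regionIndex x = 2 * c := by
  rw [le_antisymm_iff, le_natCast_iff_regionIndex, ← not_lt (b := (c : ℝ≥0)),
    lt_natCast_iff_regionIndex]
  omega

theorem natCast_eq_iff_regionIndex {c : ℕ} : (c : ℝ≥0) = x ↔ 2 * c = regionIndex x := by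
  rw [eq_comm, eq_natCast_iff_regionIndex, eq_comm]

theorem regionEq_iff_regionIndex_eq : RegionEq x y ↔ regionIndex x = regionIndex y := by
  simp only [RegionEq, natCast_eq_iff_regionIndex, floor_eq_regionIndex_div_two]
  omega

theorem regionEq_of_forall_natCast (hlt : ∀ c : ℕ, (c : ℝ≥0) < x ↔ (c : ℝ≥0) < y)
    (hgt : ∀ c : ℕ, x < (c : ℝ≥0) ↔ y < (c : ℝ≥0)) : RegionEq x y := by
  simp only [natCast_lt_iff_regionIndex, lt_natCast_iff_regionIndex] at hlt hgt
  rw [regionEq_iff_regionIndex_eq]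
  have h₁ := hlt (regionIndex y / 2)
  have h₂ := hgt ((regionIndex x + 1) / 2)
  have h₃ := hgt ((regionIndex y + 1) / 2)
  omega

theorem regionEqUpTo_iff_min_regionIndex_eq :
    RegionEqUpTo K x y ↔ min (regionIndex x) (2 * K + 1) = min (regionIndex y) (2 * K + 1) := by
  simp only [RegionEqUpTo, regionEq_iff_regionIndex_eq, natCast_lt_iff_regionIndex]
  omega

theorem exists_fin_eq_iff_regionEqUpTo (K : ℕ) :
    ∃ r : ℝ≥0 → Fin (2 * K + 2), ∀ x y, r x = r y ↔ RegionEqUpTo K x y :=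
  ⟨fun x => ⟨min (regionIndex x) (2 * K + 1), by omega⟩, fun x y => by
    rw [Fin.mk.injEq, regionEqUpTo_iff_min_regionIndex_eq]⟩

theorem RegionEq.refl (x : ℝ≥0) : RegionEq x x := regionEq_iff_regionIndex_eq.2 rfl

theorem RegionEq.symm (h : RegionEq x y) : RegionEq y x :=
  regionEq_iff_regionIndex_eq.2 (regionEq_iff_regionIndex_eq.1 h).symm

theorem RegionEq.upTo (h : RegionEq x y) (K : ℕ) : RegionEqUpTo K x y := Or.inl h

theorem RegionEq.eq_of_eq_natCast (h : RegionEq x y) {n : ℕ} (hx : x = n) : y = n :=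
  eq_natCast_iff_regionIndex.2
    ((regionEq_iff_regionIndex_eq.1 h).symm.trans (eq_natCast_iff_regionIndex.1 hx))

theorem RegionEq.eq_zero_iff (h : RegionEq x y) : x = 0 ↔ y = 0 := by
  rw [← Nat.cast_zero]
  exact ⟨h.eq_of_eq_natCast, h.symm.eq_of_eq_natCast⟩

theorem RegionEqUpTo.refl (K : ℕ) (x : ℝ≥0) : RegionEqUpTo K x x := (RegionEq.refl x).upTo K

theorem RegionEqUpTo.symm (h : RegionEqUpTo K x y) : RegionEqUpTo K y x :=
  h.imp RegionEq.symm And.symm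

theorem RegionEqUpTo.trans (h : RegionEqUpTo K x y) (h' : RegionEqUpTo K y z) :
    RegionEqUpTo K x z := by
  rw [regionEqUpTo_iff_min_regionIndex_eq] at *
  exact Eq.trans h h'

theorem RegionEqUpTo.add_natCast (h : RegionEqUpTo K x y) (n : ℕ) :
    RegionEqUpTo K (x + n) (y + n) := by
  simp only [regionEqUpTo_iff_min_regionIndex_eq, regionIndex_add_natCast] at *
  omega

theorem setOf_regionEqUpTo_natCast {n : ℕ} (hn : n ≤ K) :
    {z | RegionEqUpTo K n z} = {(n : ℝ≥0)} := by
  ext z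
  have hn' : regionIndex n = 2 * n := eq_natCast_iff_regionIndex.1 rfl
  simp only [Set.mem_ofPred_eq, Set.mem_singleton_iff, regionEqUpTo_iff_min_regionIndex_eq,
    eq_natCast_iff_regionIndex, hn']
  omega

theorem IsRegion.regionEqUpTo {S : Set ℝ≥0} (hS : IsRegion K S) (hx : x ∈ S) (hy : y ∈ S) :
    RegionEqUpTo K x y := by
  obtain ⟨z, rfl⟩ := hS
  exact RegionEqUpTo.trans (RegionEqUpTo.symm hx) hy

theorem IsRegion.eq_setOf_regionEqUpTo {S : Set ℝ≥0} (hS : IsRegion K S) (hx : x ∈ S) :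
    S = {z | RegionEqUpTo K x z} := by
  refine Set.Subset.antisymm (fun z hz => hS.regionEqUpTo hx hz) fun z hz => ?_
  obtain ⟨y, rfl⟩ := hS
  exact RegionEqUpTo.trans hx hz

theorem Constraint.mem_sat_congr (φ : Constraint) (hφ : φ.maxConst ≤ K)
    (h : RegionEqUpTo K x y) : x ∈ φ.sat ↔ y ∈ φ.sat := by
  induction φ with
  | and φ ψ ihφ ihψ =>
    obtain ⟨hφ, hψ⟩ := max_le_iff.1 hφ
    exact and_congr (ihφ hφ) (ihψ hψ)
  | gt c | eq c | lt c =>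
    simp only [Constraint.maxConst, Constraint.sat, Set.mem_ofPred_eq,
      regionEqUpTo_iff_min_regionIndex_eq, natCast_lt_iff_regionIndex,
      lt_natCast_iff_regionIndex, eq_natCast_iff_regionIndex] at *
    omega

theorem phi_eq_ite_regionIndex (K : ℕ) (x : ℝ≥0) :
    phi K x =
      if regionIndex x ≤ 2 * K then
        if 2 * (regionIndex x / 2) = regionIndex x then .eq (regionIndex x / 2)
        else .and (.gt (regionIndex x / 2)) (.lt ((regionIndex x + 1) / 2))
      else .gt K := by
  have hle : (x : ℝ≥0∞) ≤ ((K : ℕ∞) : ℝ≥0∞) ↔ regionIndex x ≤ 2 * K := by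
    rw [ENat.toENNReal_coe, ← ENNReal.coe_natCast, ENNReal.coe_le_coe, le_natCast_iff_regionIndex]
  simp only [phi, hle, natCast_eq_iff_regionIndex, floor_eq_regionIndex_div_two,
    ceil_eq_regionIndex_add_one_div_two, ENat.toNat_natCast]

theorem phi_of_lt (h : (K : ℝ≥0) < x) : phi K x = .gt K := by
  rw [phi_eq_ite_regionIndex, if_neg (natCast_lt_iff_regionIndex.1 h).not_ge]

theorem maxConst_phi_le (K : ℕ) (x : ℝ≥0) : (phi K x).maxConst ≤ K := by
  rw [phi_eq_ite_regionIndex]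
  split_ifs <;> simp only [Constraint.maxConst] <;> omega

theorem sat_phi (K : ℕ) (x : ℝ≥0) : (phi K x).sat = {z | RegionEqUpTo K x z} := by
  ext z
  rw [phi_eq_ite_regionIndex]
  split_ifs <;>
    simp only [Constraint.sat, Set.mem_ofPred_eq, Set.mem_inter_iff,
      regionEqUpTo_iff_min_regionIndex_eq, natCast_lt_iff_regionIndex, lt_natCast_iff_regionIndex,
      eq_natCast_iff_regionIndex] <;>
    omega

theorem self_mem_sat_phi (K : ℕ) (x : ℝ≥0) : x ∈ (phi K x).sat := by
  rw [sat_phi]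
  exact .refl K x

theorem phi_congr (h : RegionEqUpTo K x y) : phi K x = phi K y := by
  rcases h with h | ⟨hx, hy⟩
  · rw [phi_eq_ite_regionIndex, phi_eq_ite_regionIndex, regionEq_iff_regionIndex_eq.1 h]
  · rw [phi_of_lt hx, phi_of_lt hy]

end Regions

/-! ### Half-integers -/

section HalfIntegral

variable {K : ℕ} {x y : ℝ≥0}

/-- Half-integers. They represent the regions: each class of `RegionEq` contains exactly one. -/
def HalfIntegral (x : ℝ≥0) : Prop := ∃ n : ℕ, x = (n : ℝ≥0) / 2

theorem halfIntegral_zero : HalfIntegral 0 := ⟨0, by simp⟩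

theorem HalfIntegral.add (hx : HalfIntegral x) (hy : HalfIntegral y) : HalfIntegral (x + y) := by
  obtain ⟨m, rfl⟩ := hx
  obtain ⟨n, rfl⟩ := hy
  exact ⟨m + n, by rw [Nat.cast_add, add_div]⟩

theorem natCast_half_lt_natCast_iff {n c : ℕ} : (n : ℝ≥0) / 2 < c ↔ n < 2 * c := by
  rw [div_lt_iff₀ two_pos, mul_comm]
  norm_cast

theorem natCast_lt_natCast_half_iff {n c : ℕ} : (c : ℝ≥0) < n / 2 ↔ 2 * c < n := by
  rw [lt_div_iff₀ two_pos, mul_comm]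
  norm_cast

theorem regionIndex_natCast_half (n : ℕ) : regionIndex ((n : ℝ≥0) / 2) = n := by
  have hlt (c : ℕ) : regionIndex ((n : ℝ≥0) / 2) < 2 * c ↔ n < 2 * c :=
    lt_natCast_iff_regionIndex.symm.trans natCast_half_lt_natCast_iff
  have hgt (c : ℕ) : 2 * c < regionIndex ((n : ℝ≥0) / 2) ↔ 2 * c < n :=
    natCast_lt_iff_regionIndex.symm.trans natCast_lt_natCast_half_iff
  have h₁ := hlt (n / 2)
  have h₂ := hlt (n / 2 + 1)
  have h₃ := hgt (n / 2)
  omega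

theorem HalfIntegral.eq_regionIndex_half (hx : HalfIntegral x) : x = (regionIndex x : ℝ≥0) / 2 := by
  obtain ⟨n, rfl⟩ := hx
  rw [regionIndex_natCast_half]

theorem HalfIntegral.regionIndex_add (hx : HalfIntegral x) (hy : HalfIntegral y) :
    regionIndex (x + y) = regionIndex x + regionIndex y := by
  obtain ⟨m, rfl⟩ := hx
  obtain ⟨n, rfl⟩ := hy
  simp only [← add_div, ← Nat.cast_add, regionIndex_natCast_half]

theorem HalfIntegral.eq_of_regionEq (hx : HalfIntegral x) (hy : HalfIntegral y)
    (h : RegionEq x y) : x = y := by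
  rw [hx.eq_regionIndex_half, hy.eq_regionIndex_half, regionEq_iff_regionIndex_eq.1 h]

theorem HalfIntegral.eq_or_lt_of_regionEqUpTo (hx : HalfIntegral x) (hy : HalfIntegral y)
    (h : RegionEqUpTo K x y) : x = y ∨ (K : ℝ≥0) < x ∧ (K : ℝ≥0) < y :=
  h.imp_left (hx.eq_of_regionEq hy)

theorem HalfIntegral.exists_eq_natCast_of_add (hx : HalfIntegral x) (hy : HalfIntegral y)
    (hy' : ∀ n : ℕ, y ≠ n) (hxy : ∀ n : ℕ, x + y ≠ n) : ∃ n : ℕ, x = n := by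
  have h₁ := hy' (regionIndex y / 2)
  have h₂ := hxy (regionIndex (x + y) / 2)
  refine ⟨regionIndex x / 2, ?_⟩
  rw [Ne, eq_natCast_iff_regionIndex] at h₁ h₂
  rw [hx.regionIndex_add hy] at h₂
  rw [eq_natCast_iff_regionIndex]
  omega

theorem HalfIntegral.exists_regionEq_add (hy : HalfIntegral y) (h : RegionEq x y) (t : ℝ≥0) :
    ∃ n : ℕ, RegionEq (x + t) (y + (n : ℝ≥0) / 2) := by
  have hle : regionIndex x ≤ regionIndex (x + t) := regionIndex_mono le_self_add
  refine ⟨regionIndex (x + t) - regionIndex x, ?_⟩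
  rw [regionEq_iff_regionIndex_eq] at h ⊢
  rw [hy.regionIndex_add ⟨_, rfl⟩, regionIndex_natCast_half]
  omega

theorem finite_range_phi (K : ℕ) : (Set.range fun x : ℝ≥0 => phi K x).Finite := by
  refine ((Set.finite_Iic (2 * K + 1)).image fun n : ℕ => phi K ((n : ℝ≥0) / 2)).subset ?_
  rintro _ ⟨x, rfl⟩
  refine ⟨min (regionIndex x) (2 * K + 1), Set.mem_Iic.2 (min_le_right _ _), phi_congr ?_⟩
  rw [regionEqUpTo_iff_min_regionIndex_eq, regionIndex_natCast_half, min_assoc, min_self]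

end HalfIntegral

/-! ### Runs of timed automata -/

namespace OneTA

variable {α Q : Type*} {A : OneTA α Q} {c c' c'' : Q × ℝ≥0} {u w : TimedWord α} {K : ℕ}

/-- The transition `θ` can be taken in state `q` on the letter `a` when the clock value, after the
delay, is `x`. -/
def Fires (A : OneTA α Q) (q : Q) (a : α) (x : ℝ≥0) (θ : Transition α Q) : Prop :=
  θ ∈ A.trans ∧ θ.src = q ∧ θ.letter = a ∧ x ∈ θ.guard.sat

theorem reaches_nil : A.Reaches c [] c' ↔ c' = c := by
  constructor
  · rintro ⟨_, h⟩
    cases h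
    rfl
  · rintro rfl
    exact ⟨[], .nil _⟩

theorem reaches_cons {p : ℝ≥0 × α} :
    A.Reaches c (p :: w) c' ↔ ∃ θ, A.Fires c.1 p.2 (c.2 + p.1) θ ∧
      A.Reaches (θ.tgt, if θ.reset then 0 else c.2 + p.1) w c' := by
  constructor
  · rintro ⟨e, h⟩
    generalize hw : p :: w = w' at h
    cases h with
    | nil => cases hw
    | cons θ ν t w e c' hθ hg hrun =>
      cases hw
      exact ⟨θ, ⟨hθ, rfl, rfl, hg⟩, e, hrun⟩
  · obtain ⟨q, x⟩ := c
    obtain ⟨t, a⟩ := p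
    rintro ⟨θ, ⟨hθ, rfl, rfl, hg⟩, e, hrun⟩
    exact ⟨θ :: e, .cons θ x t w e c' hθ hg hrun⟩

theorem reaches_append :
    A.Reaches c (u ++ w) c' ↔ ∃ d, A.Reaches c u d ∧ A.Reaches d w c' := by
  induction u generalizing c with
  | nil => simp only [List.nil_append, reaches_nil, exists_eq_left]
  | cons p u ih =>
    simp only [List.cons_append, reaches_cons, ih]
    constructor
    · rintro ⟨θ, hθ, d, hd, hd'⟩
      exact ⟨d, ⟨θ, hθ, hd⟩, hd'⟩
    · rintro ⟨d, ⟨θ, hθ, hd⟩, hd'⟩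
      exact ⟨θ, hθ, d, hd, hd'⟩

theorem reaches_concat {p : ℝ≥0 × α} :
    A.Reaches c (w ++ [p]) c' ↔ ∃ d θ, A.Reaches c w d ∧ A.Fires d.1 p.2 (d.2 + p.1) θ ∧
      c' = (θ.tgt, if θ.reset then 0 else d.2 + p.1) := by
  simp only [reaches_append, reaches_cons, reaches_nil, exists_and_left]

theorem deterministic_iff : A.Deterministic ↔
    ∀ q a x θ θ', A.Fires q a x θ → A.Fires q a x θ' → θ = θ' := by
  constructor
  · rintro hA _ _ x θ θ' ⟨hθ, rfl, rfl, hx⟩ ⟨hθ', hq, ha, hx'⟩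
    by_contra hne
    rcases hA θ hθ θ' hθ' hne with h | h | h
    · exact h hq.symm
    · exact h ha.symm
    · exact Set.disjoint_left.1 h hx hx'
  · intro hA θ hθ θ' hθ' hne
    by_contra! h
    obtain ⟨hq, ha, hdisj⟩ := h
    obtain ⟨x, hx, hx'⟩ := Set.not_disjoint_iff.1 hdisj
    exact hne (hA _ _ x θ θ' ⟨hθ, hq, ha, hx⟩ ⟨hθ', rfl, rfl, hx'⟩)

theorem Deterministic.run_unique (hA : A.Deterministic) {e e' : List (Transition α Q)}
    (h : A.Run c w e c') (h' : A.Run c w e' c'') : e = e' ∧ c' = c'' := by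
  induction h generalizing e' with
  | nil c => cases h'; exact ⟨rfl, rfl⟩
  | cons θ ν t w e c' hθ hg _ ih =>
    generalize hq : θ.src = q at h'
    generalize ha : θ.letter = a at h'
    cases h' with
    | cons θ' _ _ _ e' _ hθ' hg' hrun' =>
      obtain rfl : θ = θ' :=
        deterministic_iff.1 hA _ _ _ _ _ ⟨hθ, hq, ha, hg⟩ ⟨hθ', rfl, rfl, hg'⟩
      obtain ⟨rfl, rfl⟩ := ih hrun'
      exact ⟨rfl, rfl⟩

theorem Deterministic.reaches_unique (hA : A.Deterministic) (h : A.Reaches c w c')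
    (h' : A.Reaches c w c'') : c' = c'' :=
  (hA.run_unique h.choose_spec h'.choose_spec).2

theorem Deterministic.complete (hA : A.Deterministic)
    (h : ∀ w, ∃ c, A.Reaches (A.init, 0) w c) : A.Complete := fun w => by
  obtain ⟨c, e, he⟩ := h w
  exact ⟨e, ⟨c, he⟩, fun e' ⟨c', he'⟩ => (hA.run_unique he' he).1⟩

theorem Complete.exists_reaches (hA : A.Complete) (w : TimedWord α) :
    ∃ c, A.Reaches (A.init, 0) w c := by
  obtain ⟨e, ⟨c, he⟩, -⟩ := hA w
  exact ⟨c, e, he⟩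

theorem HasMaxConst.maxConst_le (hA : A.HasMaxConst K) {θ : Transition α Q} (hθ : θ ∈ A.trans) :
    θ.guard.maxConst ≤ K :=
  hA.1 ⟨θ, hθ, rfl⟩

theorem IsDTA.exists_hasMaxConst (hA : A.IsDTA) : ∃ K, A.HasMaxConst K := by
  have himage : {c | ∃ θ ∈ A.trans, c = θ.guard.maxConst} =
      (fun θ => θ.guard.maxConst) '' A.trans := by
    simp only [Set.image, eq_comm]
  simp only [HasMaxConst, himage]
  rcases A.trans.eq_empty_or_nonempty with h | h
  · simp only [h, Set.image_empty]
    exact ⟨0, isLUB_empty⟩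
  · exact ⟨_, isLUB_csSup (h.image _) (hA.finite_trans.image _).bddAbove⟩

theorem finite_trans_of_guard_eq_phi [Finite α] [Finite Q]
    (h : ∀ θ ∈ A.trans, ∃ x, θ.guard = phi K x) : A.trans.Finite := by
  have hfin : ((Set.univ : Set (Q × Q × α × Bool)) ×ˢ (Set.range fun x : ℝ≥0 => phi K x)).Finite :=
    Set.finite_univ.prod (finite_range_phi K)
  refine (hfin.image fun p => ⟨p.1.1, p.1.2.1, p.1.2.2.1, p.2, p.1.2.2.2⟩).subset fun θ hθ => ?_
  obtain ⟨x, hx⟩ := h θ hθ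
  exact ⟨((θ.src, θ.tgt, θ.letter, θ.reset), θ.guard), ⟨Set.mem_univ _, x, hx.symm⟩, rfl⟩

theorem hasMaxConst_of_guard_eq_phi (h : ∀ θ ∈ A.trans, ∃ x, θ.guard = phi K x)
    (hempty : IsEmpty α → K = 0) (hgt : α → ∃ θ ∈ A.trans, θ.guard = .gt K) :
    A.HasMaxConst K := by
  constructor
  · rintro _ ⟨θ, hθ, rfl⟩
    obtain ⟨x, hx⟩ := h θ hθ
    rw [hx]
    exact maxConst_phi_le K x
  · intro b hb
    rcases isEmpty_or_nonempty α with hα | ⟨⟨a⟩⟩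
    · rw [hempty hα]
      exact Nat.zero_le b
    · obtain ⟨θ, hθ, hguard⟩ := hgt a
      exact hb ⟨θ, hθ, by rw [hguard, Constraint.maxConst]⟩

end OneTA

/-! ### Region automata -/

/-- Complete deterministic one-clock automata (without initial state), presented by a transition
function on pairs (letter, clock value) that depends only on the `K`-region of the clock value;
the Boolean tells whether the clock is reset. -/
structure RegionAutomaton (α Q : Type*) (K : ℕ) where
  step : Q → α → ℝ≥0 → Q × Bool
  accept : Set Q
  step_congr : ∀ q a x y, RegionEqUpTo K x y → step q a x = step q a y

namespace RegionAutomaton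

variable {α Q Q' : Type*} {K K' : ℕ}

/-- The configuration after reading one timed letter. -/
noncomputable def next (A : RegionAutomaton α Q K) (c : Q × ℝ≥0) (p : ℝ≥0 × α) : Q × ℝ≥0 :=
  ((A.step c.1 p.2 (c.2 + p.1)).1, if (A.step c.1 p.2 (c.2 + p.1)).2 then 0 else c.2 + p.1)

/-- The configuration after reading a timed word. -/
noncomputable def conf (A : RegionAutomaton α Q K) (c : Q × ℝ≥0) (w : TimedWord α) : Q × ℝ≥0 :=
  w.foldl A.next c

/-- The language accepted from a configuration. -/
def lang (A : RegionAutomaton α Q K) (c : Q × ℝ≥0) : TimedLanguage α :=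
  {w | (A.conf c w).1 ∈ A.accept}

theorem conf_cons (A : RegionAutomaton α Q K) (c : Q × ℝ≥0) (p : ℝ≥0 × α) (w : TimedWord α) :
    A.conf c (p :: w) = A.conf (A.next c p) w := rfl

theorem conf_append (A : RegionAutomaton α Q K) (c : Q × ℝ≥0) (u w : TimedWord α) :
    A.conf c (u ++ w) = A.conf (A.conf c u) w := List.foldl_append

theorem conf_concat (A : RegionAutomaton α Q K) (c : Q × ℝ≥0) (u : TimedWord α) (p : ℝ≥0 × α) :
    A.conf c (u ++ [p]) = A.next (A.conf c u) p := A.conf_append c u [p]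

theorem residual_lang (A : RegionAutomaton α Q K) (c : Q × ℝ≥0) (u : TimedWord α) :
    residual u (A.lang c) = A.lang (A.conf c u) := by
  ext w
  simp only [residual, lang, Set.mem_ofPred_eq, conf_append]

theorem lang_eq_of_bisimulation {A : RegionAutomaton α Q K} {B : RegionAutomaton α Q' K'}
    (r : Q × ℝ≥0 → Q' × ℝ≥0 → Prop) (hnext : ∀ c d p, r c d → r (A.next c p) (B.next d p))
    (haccept : ∀ c d, r c d → (c.1 ∈ A.accept ↔ d.1 ∈ B.accept)) {c : Q × ℝ≥0} {d : Q' × ℝ≥0}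
    (h : r c d) : A.lang c = B.lang d := by
  ext w
  induction w generalizing c d with
  | nil => exact haccept c d h
  | cons p _ ih => exact ih (hnext c d p h)

theorem lang_eq_of_lt (A : RegionAutomaton α Q K) (q : Q) {x y : ℝ≥0}
    (hx : (K : ℝ≥0) < x) (hy : (K : ℝ≥0) < y) : A.lang (q, x) = A.lang (q, y) := by
  refine lang_eq_of_bisimulation
    (fun c d => c.1 = d.1 ∧ (c.2 = d.2 ∨ (K : ℝ≥0) < c.2 ∧ (K : ℝ≥0) < d.2)) ?_
    (fun c d h => by rw [h.1]) ⟨rfl, Or.inr ⟨hx, hy⟩⟩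
  rintro ⟨q, x⟩ ⟨_, y⟩ p ⟨rfl, rfl | ⟨hx, hy⟩⟩
  · exact ⟨rfl, Or.inl rfl⟩
  · have hx' : (K : ℝ≥0) < x + p.1 := hx.trans_le le_self_add
    have hy' : (K : ℝ≥0) < y + p.1 := hy.trans_le le_self_add
    simp only [next, A.step_congr q p.2 _ _ (Or.inr ⟨hx', hy'⟩), true_and]
    split_ifs
    · exact Or.inl rfl
    · exact Or.inr ⟨hx', hy'⟩

theorem lang_congr_of_halfIntegral (A : RegionAutomaton α Q K) (q : Q) {x y : ℝ≥0}
    (hx : HalfIntegral x) (hy : HalfIntegral y) (h : RegionEqUpTo K x y) :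
    A.lang (q, x) = A.lang (q, y) := by
  rcases h with h | ⟨hx', hy'⟩
  · rw [hx.eq_of_regionEq hy h]
  · exact A.lang_eq_of_lt q hx' hy'

/-- Renaming of states. -/
def map (A : RegionAutomaton α Q K) (e : Q ≃ Q') : RegionAutomaton α Q' K where
  step q a x := (A.step (e.symm q) a x).map e id
  accept := e.symm ⁻¹' A.accept
  step_congr q a x y h := by rw [A.step_congr _ _ _ _ h]

theorem lang_map (A : RegionAutomaton α Q K) (e : Q ≃ Q') (q : Q) (x : ℝ≥0) :
    (A.map e).lang (e q, x) = A.lang (q, x) := by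
  refine lang_eq_of_bisimulation (fun c d => c = (e d.1, d.2)) ?_ ?_ rfl
  · rintro _ d p rfl
    simp only [next, map, Equiv.symm_apply_apply, Prod.map_fst, Prod.map_snd, id_eq]
  · rintro _ d rfl
    simp only [map, Set.mem_preimage, Equiv.symm_apply_apply]

/-- The automaton that behaves as if the clock were initially advanced by `n`: the flag of a state
tells whether the clock has not been reset yet. -/
def shift (A : RegionAutomaton α Q K) (n : ℕ) : RegionAutomaton α (Q × Bool) K where
  step q a x :=
    let s := A.step q.1 a (if q.2 then x + n else x)
    ((s.1, q.2 && !s.2), s.2)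
  accept := {q | q.1 ∈ A.accept}
  step_congr q a x y h := by
    have hstep : A.step q.1 a (if q.2 then x + n else x) =
        A.step q.1 a (if q.2 then y + n else y) := by
      split_ifs
      · exact A.step_congr _ _ _ _ (h.add_natCast n)
      · exact A.step_congr _ _ _ _ h
    rw [hstep]

theorem lang_shift (A : RegionAutomaton α Q K) (n : ℕ) (q : Q) :
    (A.shift n).lang ((q, true), 0) = A.lang (q, n) := by
  refine lang_eq_of_bisimulation
    (fun c d => d = (c.1.1, if c.1.2 then c.2 + n else c.2)) ?_ ?_ (by simp)
  · rintro ⟨⟨q, b⟩, x⟩ _ p rfl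
    have hadd : (if b then x + n else x) + p.1 = if b then x + p.1 + n else x + p.1 := by
      rw [ite_add, add_right_comm]
    simp only [next, shift, hadd, Prod.mk.injEq, true_and]
    cases b
    · simp
    · cases h : (A.step q p.2 (x + p.1 + n)).2 <;> simp [h]
  · rintro c _ rfl
    rfl

/-- The timed automaton with the transitions of a region automaton. -/
noncomputable def toTA (A : RegionAutomaton α Q K) (q₀ : Q) : OneTA α Q where
  init := q₀
  trans := {θ | ∃ q a x, θ = ⟨q, (A.step q a x).1, a, phi K x, (A.step q a x).2⟩}
  accept := A.accept

theorem toTA_fires_iff (A : RegionAutomaton α Q K) (q₀ : Q) {q : Q} {a : α} {x : ℝ≥0}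
    {θ : Transition α Q} :
    (A.toTA q₀).Fires q a x θ ↔ θ = ⟨q, (A.step q a x).1, a, phi K x, (A.step q a x).2⟩ := by
  constructor
  · rintro ⟨⟨q, a, y, rfl⟩, rfl, rfl, hx⟩
    rw [sat_phi] at hx
    simp only [A.step_congr q a y x hx, phi_congr hx]
  · rintro rfl
    exact ⟨⟨q, a, x, rfl⟩, rfl, rfl, self_mem_sat_phi K x⟩

theorem toTA_reaches_iff (A : RegionAutomaton α Q K) (q₀ : Q) {c c' : Q × ℝ≥0}
    {w : TimedWord α} : (A.toTA q₀).Reaches c w c' ↔ c' = A.conf c w := by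
  induction w generalizing c with
  | nil => exact OneTA.reaches_nil
  | cons p w ih =>
    simp only [OneTA.reaches_cons, toTA_fires_iff, exists_eq_left, ih]
    rfl

theorem language_toTA (A : RegionAutomaton α Q K) (q₀ : Q) :
    (A.toTA q₀).language = A.lang (q₀, 0) := by
  ext w
  constructor
  · rintro ⟨q, ν, hq, h⟩
    obtain rfl : q = (A.conf (q₀, 0) w).1 := congrArg Prod.fst ((A.toTA_reaches_iff q₀).1 h)
    exact hq
  · exact fun hw => ⟨_, _, hw, (A.toTA_reaches_iff q₀).2 rfl⟩

theorem isDTA_toTA [Finite α] [Finite Q] (A : RegionAutomaton α Q K) (q₀ : Q) :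
    (A.toTA q₀).IsDTA where
  finite_states := inferInstance
  finite_trans := OneTA.finite_trans_of_guard_eq_phi (K := K) <| by
    rintro _ ⟨q, a, x, rfl⟩
    exact ⟨x, rfl⟩
  deterministic := OneTA.deterministic_iff.2 fun q a x θ θ' h h' =>
    ((A.toTA_fires_iff q₀).1 h).trans ((A.toTA_fires_iff q₀).1 h').symm

theorem hasMaxConst_toTA (A : RegionAutomaton α Q K) (q₀ : Q) (hempty : IsEmpty α → K = 0) :
    (A.toTA q₀).HasMaxConst K := by
  refine OneTA.hasMaxConst_of_guard_eq_phi ?_ hempty fun a =>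
    ⟨_, ⟨q₀, a, (K : ℝ≥0) + 1, rfl⟩, phi_of_lt (lt_add_of_pos_right _ one_pos)⟩
  rintro _ ⟨q, a, x, rfl⟩
  exact ⟨x, rfl⟩

theorem exists_isDTA_language_eq [Finite α] [Finite Q] (A : RegionAutomaton α Q K) (q₀ : Q) :
    ∃ (Q' : Type) (B : OneTA α Q'), B.IsDTA ∧ ((IsEmpty α → K = 0) → B.HasMaxConst K) ∧
      B.language = A.lang (q₀, 0) := by
  obtain ⟨n, ⟨e⟩⟩ := Finite.exists_equiv_fin Q
  refine ⟨Fin n, (A.map e).toTA (e q₀), isDTA_toTA _ _, hasMaxConst_toTA _ _, ?_⟩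
  rw [language_toTA, lang_map]

theorem recognizable_lang_zero [Finite α] [Finite Q] (A : RegionAutomaton α Q K) (q : Q) :
    Recognizable (A.lang (q, 0)) := by
  obtain ⟨Q', B, hB, -, hlang⟩ := A.exists_isDTA_language_eq q
  exact ⟨Q', B, hB, hlang⟩

theorem recognizable_lang_natCast [Finite α] [Finite Q] (A : RegionAutomaton α Q K) (q : Q)
    (n : ℕ) : Recognizable (A.lang (q, n)) := by
  rw [← lang_shift]
  exact recognizable_lang_zero _ _

theorem recognizable_lang_of_lt [Finite α] [Finite Q] (A : RegionAutomaton α Q K) (q : Q)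
    {x : ℝ≥0} (hx : (K : ℝ≥0) < x) : Recognizable (A.lang (q, x)) := by
  rw [A.lang_eq_of_lt q hx (Nat.cast_lt.2 K.lt_succ_self)]
  exact A.recognizable_lang_natCast q _

end RegionAutomaton

namespace OneTA

variable {α Q : Type*} {K : ℕ} {A : OneTA α Q}

open Classical in
/-- The region automaton of a timed automaton, completed with the sink state `none`. The chosen
transition is the only one that fires if the automaton is deterministic. -/
noncomputable def toRegionAutomaton (A : OneTA α Q)
    (hK : ∀ θ ∈ A.trans, θ.guard.maxConst ≤ K) : RegionAutomaton α (Option Q) K where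
  step
    | none, _, _ => (none, true)
    | some q, a, x =>
      if h : ∃ θ, A.Fires q a x θ then (some h.choose.tgt, h.choose.reset) else (none, true)
  accept := some '' A.accept
  step_congr q a x y h := by
    cases q with
    | none => rfl
    | some q =>
      have hfires : A.Fires q a x = A.Fires q a y := funext fun θ => propext <|
        and_congr_right fun hθ => and_congr_right' <| and_congr_right' <|
          θ.guard.mem_sat_congr (hK θ hθ) h
      simp only [hfires]

theorem toRegionAutomaton_conf_none (hK : ∀ θ ∈ A.trans, θ.guard.maxConst ≤ K) (x : ℝ≥0)
    (w : TimedWord α) : ((A.toRegionAutomaton hK).conf (none, x) w).1 = none := by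
  induction w generalizing x with
  | nil => rfl
  | cons _ _ ih => exact ih 0

theorem Deterministic.toRegionAutomaton_conf_eq_iff (hA : A.Deterministic)
    (hK : ∀ θ ∈ A.trans, θ.guard.maxConst ≤ K) {q q' : Q} {x ν : ℝ≥0} {w : TimedWord α} :
    (A.toRegionAutomaton hK).conf (some q, x) w = (some q', ν) ↔ A.Reaches (q, x) w (q', ν) := by
  induction w generalizing q x with
  | nil =>
    simp only [reaches_nil, RegionAutomaton.conf, List.foldl_nil, Prod.mk.injEq, Option.some.injEq,
      eq_comm]
  | cons p w ih =>
    rw [RegionAutomaton.conf_cons, reaches_cons]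
    by_cases h : ∃ θ, A.Fires q p.2 (x + p.1) θ
    · have hfires (θ) : A.Fires q p.2 (x + p.1) θ ↔ θ = h.choose :=
        ⟨fun hθ => deterministic_iff.1 hA _ _ _ _ _ hθ h.choose_spec,
          fun hθ => hθ ▸ h.choose_spec⟩
      simp only [RegionAutomaton.next, toRegionAutomaton, dif_pos h, hfires, exists_eq_left]
      exact ih
    · simp only [RegionAutomaton.next, toRegionAutomaton, dif_neg h]
      refine iff_of_false (fun h' => ?_) fun ⟨θ, hθ, _⟩ => h ⟨θ, hθ⟩
      have hnone := toRegionAutomaton_conf_none hK (if true then 0 else x + p.1) w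
      exact Option.some_ne_none q' ((congrArg Prod.fst h').symm.trans hnone)

theorem Deterministic.lang_toRegionAutomaton (hA : A.Deterministic)
    (hK : ∀ θ ∈ A.trans, θ.guard.maxConst ≤ K) :
    (A.toRegionAutomaton hK).lang (some A.init, 0) = A.language := by
  ext w
  constructor
  · rintro ⟨q, hq, h⟩
    exact ⟨q, _, hq, (hA.toRegionAutomaton_conf_eq_iff hK).1 (Prod.ext h.symm rfl)⟩
  · rintro ⟨q, ν, hq, h⟩
    exact ⟨q, hq, (congrArg Prod.fst ((hA.toRegionAutomaton_conf_eq_iff hK).2 h)).symm⟩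

theorem IsDTA.recognizable [Finite α] (hA : A.IsDTA) : Recognizable A.language := by
  obtain ⟨K, hK⟩ := hA.exists_hasMaxConst
  have := hA.finite_states
  rw [← hA.deterministic.lang_toRegionAutomaton fun _ => hK.maxConst_le]
  exact RegionAutomaton.recognizable_lang_zero _ _

end OneTA

theorem Recognizable.exists_regionAutomaton {α : Type*} {L : TimedLanguage α}
    (hL : Recognizable L) :
    ∃ (Q : Type) (_ : Finite Q) (K : ℕ) (A : RegionAutomaton α Q K) (q : Q),
      A.lang (q, 0) = L := by
  obtain ⟨Q, B, hB, rfl⟩ := hL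
  obtain ⟨K, hK⟩ := hB.exists_hasMaxConst
  have := hB.finite_states
  exact ⟨Option Q, inferInstance, K, B.toRegionAutomaton fun _ => hK.maxConst_le, some B.init,
    hB.deterministic.lang_toRegionAutomaton _⟩

/-! ### Rescaling of time -/

section Rescaling

variable {α Q : Type*} {K : ℕ} {f : CircleDeg1Lift} {x y : ℝ≥0}

/-- The image, under a rescaling `f` of time that commutes with the translation by `1`, of a timed
word that starts to be read at time `T`. -/
noncomputable def rescale (f : CircleDeg1Lift) : ℝ → TimedWord α → TimedWord α
  | _, [] => []
  | T, p :: w => (Real.toNNReal (f (T + p.1) - f T), p.2) :: rescale f (T + p.1) w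

theorem regionEq_of_coe_eq_sub (hf : StrictMono f) {T : ℝ} (h : (y : ℝ) = f T - f (T - x)) :
    RegionEq x y := by
  refine regionEq_of_forall_natCast (fun c => ?_) fun c => ?_
  · calc (c : ℝ≥0) < x ↔ T - x + c < T := by
          rw [← NNReal.coe_lt_coe, NNReal.coe_natCast]
          constructor <;> intro <;> linarith
      _ ↔ f (T - x) + c < f T := by rw [← hf.lt_iff_lt, f.map_add_nat]
      _ ↔ (c : ℝ≥0) < y := by rw [← lt_sub_iff_add_lt', ← h]; norm_cast
  · calc x < (c : ℝ≥0) ↔ T < T - x + c := by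
          rw [← NNReal.coe_lt_coe, NNReal.coe_natCast]
          constructor <;> intro <;> linarith
      _ ↔ f T < f (T - x) + c := by rw [← hf.lt_iff_lt, f.map_add_nat]
      _ ↔ y < (c : ℝ≥0) := by rw [← sub_lt_iff_lt_add', ← h]; norm_cast

theorem RegionAutomaton.rescale_mem_lang_iff (A : RegionAutomaton α Q K) (hf : StrictMono f)
    (w : TimedWord α) (q : Q) {T : ℝ} (h : (y : ℝ) = f T - f (T - x)) :
    rescale f T w ∈ A.lang (q, y) ↔ w ∈ A.lang (q, x) := by
  induction w generalizing q x y T with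
  | nil => rfl
  | cons p w ih =>
    have hdelay : 0 ≤ f (T + p.1) - f T :=
      sub_nonneg.2 (f.monotone (le_add_of_nonneg_right p.1.coe_nonneg))
    have hclock : ((y + Real.toNNReal (f (T + p.1) - f T) : ℝ≥0) : ℝ) =
        f (T + p.1) - f (T + p.1 - (x + p.1 : ℝ≥0)) := by
      push_cast
      rw [Real.coe_toNNReal _ hdelay, h, add_sub_add_right_eq_sub]
      ring
    change rescale f (T + p.1) w ∈ A.lang (A.next (q, y) _) ↔ w ∈ A.lang (A.next (q, x) p)
    simp only [next, A.step_congr q p.2 _ _ ((regionEq_of_coe_eq_sub hf hclock).upTo K)]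
    split_ifs
    · exact ih _ (by simp)
    · exact ih _ hclock

theorem strictMono_floor_add_fract_rpow {p : ℝ} (hp : 0 < p) :
    StrictMono fun s : ℝ => ⌊s⌋ + Int.fract s ^ p := by
  intro s s' hs
  dsimp only
  rcases (Int.floor_mono hs.le).lt_or_eq with hfloor | hfloor
  · have h₁ : Int.fract s ^ p < 1 := Real.rpow_lt_one (Int.fract_nonneg s) (Int.fract_lt_one s) hp
    have h₂ : 0 ≤ Int.fract s' ^ p := Real.rpow_nonneg (Int.fract_nonneg s') p
    have h₃ : (⌊s⌋ : ℝ) + 1 ≤ ⌊s'⌋ := by exact_mod_cast hfloor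
    linarith
  · have hfract : Int.fract s < Int.fract s' := by
      rw [Int.fract, Int.fract, hfloor]
      exact sub_lt_sub_right hs _
    rw [hfloor]
    exact add_lt_add_right (Real.rpow_lt_rpow (Int.fract_nonneg s) hfract hp) _

theorem RegionEq.exists_circleDeg1Lift (h : RegionEq x y) :
    ∃ f : CircleDeg1Lift, StrictMono f ∧ f 0 = 0 ∧ f x = y := by
  by_cases hx : (⌊x⌋₊ : ℝ≥0) = x
  · exact ⟨1, strictMono_id, rfl, congrArg NNReal.toReal (hx.symm.trans
      (h.eq_of_eq_natCast hx.symm).symm)⟩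
  have hy : (⌊y⌋₊ : ℝ≥0) ≠ y := fun hy => hx (h.2.2 hy)
  have hfloor (z : ℝ≥0) : (⌊(z : ℝ)⌋ : ℝ) = (⌊z⌋₊ : ℝ≥0) :=
    (natCast_floor_eq_intCast_floor z.coe_nonneg).symm
  have fract_mem {z : ℝ≥0} (hz : (⌊z⌋₊ : ℝ≥0) ≠ z) : Int.fract (z : ℝ) ∈ Set.Ioo (0 : ℝ) 1 := by
    refine ⟨Int.fract_pos.2 fun hz' => hz ?_, Int.fract_lt_one _⟩
    rw [← NNReal.coe_inj, ← hfloor, ← hz']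
  have hp : 0 < Real.logb (Int.fract x) (Int.fract y) := Real.logb_pos_of_base_lt_one
    (fract_mem hx).1 (fract_mem hx).2 (fract_mem hy).1 (fract_mem hy).2
  have hf := strictMono_floor_add_fract_rpow hp
  refine ⟨⟨⟨_, hf.monotone⟩, fun s => ?_⟩, hf, ?_, ?_⟩
  · simp [add_right_comm]
  · simp [Real.zero_rpow hp.ne']
  · change ⌊(x : ℝ)⌋ + Int.fract (x : ℝ) ^ Real.logb (Int.fract x) (Int.fract y) = y
    rw [Real.rpow_logb (fract_mem hx).1 (fract_mem hx).2.ne (fract_mem hy).1, hfloor, h.1,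
      ← hfloor, Int.floor_add_fract]

theorem RegionAutomaton.lang_eq_of_recognizable (A : RegionAutomaton α Q K) (q : Q)
    (h : RegionEq x y) (hrec : Recognizable (A.lang (q, y))) : A.lang (q, x) = A.lang (q, y) := by
  obtain ⟨f, hf, hf₀, hfx⟩ := h.exists_circleDeg1Lift
  obtain ⟨Q', _, K', B, q', hB⟩ := hrec.exists_regionAutomaton
  ext w
  rw [← A.rescale_mem_lang_iff hf w q (T := x) (y := y) (by simp [hf₀, hfx]), ← hB,
    B.rescale_mem_lang_iff hf w q' (x := 0) (by simp)]

end Rescaling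

/-! ### The syntactic reset function of a recognizable language -/

section ClockFamily

variable {α : Type*} {L : TimedLanguage α} {M : ℝ≥0 → TimedLanguage α} {x y : ℝ≥0}

/-- The families of languages accepted by a finite region automaton from a fixed state, as a
function of the initial clock value. -/
def IsClockFamily (M : ℝ≥0 → TimedLanguage α) : Prop :=
  ∃ (Q : Type) (_ : Finite Q) (K : ℕ) (A : RegionAutomaton α Q K) (q : Q),
    M = fun x => A.lang (q, x)

theorem Recognizable.exists_isClockFamily (hL : Recognizable L) :
    ∃ M, IsClockFamily M ∧ M 0 = L := by
  obtain ⟨Q, hQ, K, A, q, hA⟩ := hL.exists_regionAutomaton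
  exact ⟨_, ⟨Q, hQ, K, A, q, rfl⟩, hA⟩

theorem IsClockFamily.recognizable_natCast [Finite α] (hM : IsClockFamily M) (n : ℕ) :
    Recognizable (M n) := by
  obtain ⟨Q, _, K, A, q, rfl⟩ := hM
  exact A.recognizable_lang_natCast q n

theorem IsClockFamily.eq_of_recognizable (hM : IsClockFamily M) (h : RegionEq x y)
    (hrec : Recognizable (M y)) : M x = M y := by
  obtain ⟨Q, _, K, A, q, rfl⟩ := hM
  exact A.lang_eq_of_recognizable q h hrec

theorem IsClockFamily.exists_residual_singleton (hM : IsClockFamily M) (a : α) (x : ℝ≥0) :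
    ∃ N, IsClockFamily N ∧
      ((∀ y t, RegionEq x (y + t) → residual [(t, a)] (M y) = N 0) ∨
        ∀ y t, RegionEq x (y + t) → residual [(t, a)] (M y) = N (y + t)) := by
  obtain ⟨Q, hQ, K, A, q, rfl⟩ := hM
  have hres (y t) (h : RegionEq x (y + t)) : residual [(t, a)] (A.lang (q, y)) =
      A.lang ((A.step q a x).1, if (A.step q a x).2 then 0 else y + t) := by
    rw [A.residual_lang, A.step_congr q a x _ (h.upTo K)]
    rfl
  refine ⟨fun z => A.lang ((A.step q a x).1, z), ⟨Q, hQ, K, A, _, rfl⟩, ?_⟩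
  cases hreset : (A.step q a x).2
  · exact Or.inr fun y t h => by rw [hres y t h, hreset, if_neg Bool.false_ne_true]
  · exact Or.inl fun y t h => by rw [hres y t h, hreset, if_pos rfl]

end ClockFamily

section SyntacticReset

variable {α : Type*} {L : TimedLanguage α} {u v w : TimedWord α}

theorem residual_append (u w : TimedWord α) (L : TimedLanguage α) :
    residual (u ++ w) L = residual w (residual u L) := by
  ext x
  simp only [residual, Set.mem_ofPred_eq, List.append_assoc]

theorem mem_iff_nil_mem_residual : w ∈ L ↔ [] ∈ residual w L := by
  rw [residual, Set.mem_ofPred_eq, List.append_nil]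

theorem synResetVal_of_recognizable (h : Recognizable (residual w L)) : synResetVal L w = 0 := by
  cases w using List.reverseRecOn with
  | nil => exact synResetVal_nil L
  | append_singleton w p => rw [synResetVal_concat, if_pos h]

theorem synResetVal_concat_of_not_recognizable {p : ℝ≥0 × α}
    (h : ¬ Recognizable (residual (w ++ [p]) L)) :
    synResetVal L (w ++ [p]) = synResetVal L w + p.1 := by
  rw [synResetVal_concat, if_neg h]

theorem synResetVal_concat_of_ne_zero {p : ℝ≥0 × α} (h : synResetVal L (w ++ [p]) ≠ 0) :
    synResetVal L (w ++ [p]) = synResetVal L w + p.1 :=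
  synResetVal_concat_of_not_recognizable fun hrec => h (synResetVal_of_recognizable hrec)

/-- The simulation that makes half-integral words representative: the residual languages of `u`
and `v` are the members of one clock family at region-equivalent clock values, namely at the values
of the syntactic reset function. -/
def RegionSimilar (L : TimedLanguage α) (u v : TimedWord α) : Prop :=
  RegionEq (synResetVal L u) (synResetVal L v) ∧
    ∃ M, IsClockFamily M ∧ residual u L = M (synResetVal L u) ∧
      residual v L = M (synResetVal L v)

theorem RegionSimilar.of_recognizable (hu : Recognizable (residual u L))
    (h : residual u L = residual v L) : RegionSimilar L u v := by
  have hu₀ := synResetVal_of_recognizable hu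
  have hv₀ := synResetVal_of_recognizable (h ▸ hu)
  obtain ⟨M, hM, hM₀⟩ := hu.exists_isClockFamily
  rw [RegionSimilar, hu₀, hv₀]
  exact ⟨.refl 0, M, hM, hM₀.symm, h.symm.trans hM₀.symm⟩

theorem RegionSimilar.nil (hL : Recognizable L) : RegionSimilar L [] [] :=
  .of_recognizable hL rfl

theorem RegionSimilar.concat [Finite α] (h : RegionSimilar L u v) {t s : ℝ≥0}
    (hts : RegionEq (synResetVal L u + t) (synResetVal L v + s)) (a : α) :
    RegionSimilar L (u ++ [(t, a)]) (v ++ [(s, a)]) := by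
  obtain ⟨-, M, hM, hu, hv⟩ := h
  obtain ⟨N, hN, hres⟩ := hM.exists_residual_singleton a (synResetVal L u + t)
  rcases hres with hres | hres
  · have hu' : residual (u ++ [(t, a)]) L = N 0 := by
      rw [residual_append, hu, hres _ _ (.refl _)]
    have hv' : residual (v ++ [(s, a)]) L = N 0 := by rw [residual_append, hv, hres _ _ hts]
    refine .of_recognizable ?_ (hu'.trans hv'.symm)
    simpa only [hu', Nat.cast_zero] using hN.recognizable_natCast 0
  · have hu' : residual (u ++ [(t, a)]) L = N (synResetVal L u + t) := by
      rw [residual_append, hu, hres _ _ (.refl _)]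
    have hv' : residual (v ++ [(s, a)]) L = N (synResetVal L v + s) := by
      rw [residual_append, hv, hres _ _ hts]
    have heq (hrec : Recognizable (residual (u ++ [(t, a)]) L)) :
        residual (u ++ [(t, a)]) L = residual (v ++ [(s, a)]) L := by
      rw [hu', hv', hN.eq_of_recognizable hts.symm (hu' ▸ hrec)]
    by_cases hrec : Recognizable (residual (u ++ [(t, a)]) L)
    · exact .of_recognizable hrec (heq hrec)
    · have hrec' : ¬ Recognizable (residual (v ++ [(s, a)]) L) := fun h => hrec <| by
        rwa [hu', hN.eq_of_recognizable hts (hv' ▸ h), ← hv']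
      rw [RegionSimilar, synResetVal_concat_of_not_recognizable hrec,
        synResetVal_concat_of_not_recognizable hrec']
      exact ⟨hts, N, hN, hu', hv'⟩

theorem RegionSimilar.refl [Finite α] (hL : Recognizable L) (w : TimedWord α) :
    RegionSimilar L w w := by
  induction w using List.reverseRecOn with
  | nil => exact .nil hL
  | append_singleton w p ih => exact ih.concat (.refl _) p.2

theorem RegionSimilar.mem_iff (h : RegionSimilar L u v) : u ∈ L ↔ v ∈ L := by
  obtain ⟨-, M, ⟨Q, -, K, A, q, rfl⟩, hu, hv⟩ := h
  rw [mem_iff_nil_mem_residual, mem_iff_nil_mem_residual (w := v), hu, hv]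
  rfl

theorem recognizable_residual_of_synResetVal_eq_natCast [Finite α] (hL : Recognizable L) {n : ℕ}
    (h : synResetVal L w = n) : Recognizable (residual w L) := by
  obtain ⟨-, M, hM, hw, -⟩ := RegionSimilar.refl hL w
  rw [hw, h]
  exact hM.recognizable_natCast n

theorem synResetVal_eq_zero_of_eq_natCast [Finite α] (hL : Recognizable L) {n : ℕ}
    (h : synResetVal L w = n) : synResetVal L w = 0 :=
  synResetVal_of_recognizable (recognizable_residual_of_synResetVal_eq_natCast hL h)

end SyntacticReset

section HalfIntegralWords

variable {α : Type*} {L : TimedLanguage α}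

@[elab_as_elim]
theorem HI.induction {P : HI α → Prop} (nil : P HI.nil)
    (concat : ∀ v n a, P v → P (v.concat n a)) (v : HI α) : P v := by
  obtain ⟨w, hw⟩ := v
  induction w using List.reverseRecOn with
  | nil => exact nil
  | append_singleton w p ih =>
    obtain ⟨t, a⟩ := p
    obtain ⟨n, rfl⟩ := hw (t, a) (by simp)
    exact concat ⟨w, fun q hq => hw q (List.mem_append_left _ hq)⟩ n a (ih _)

theorem HI.halfIntegral_synResetVal (L : TimedLanguage α) (v : HI α) :
    HalfIntegral (synResetVal L v.1) := by
  induction v using HI.induction with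
  | nil => exact (synResetVal_nil L).symm ▸ halfIntegral_zero
  | concat v n a ih =>
    rw [HI.concat, synResetVal_concat]
    split_ifs
    · exact halfIntegral_zero
    · exact ih.add ⟨n, rfl⟩

theorem synRel_concat {u v : HI α} (h : (synRel L).r u v) (n : ℕ) (a : α) :
    (synRel L).r (u.concat n a) (v.concat n a) := by
  obtain ⟨hreset, hres⟩ := h
  change synResetVal L u.1 = synResetVal L v.1 at hreset
  have hres' : residual (u.concat n a).1 L = residual (v.concat n a).1 L := by
    simp only [HI.concat, residual_append, hres]
  refine ⟨?_, hres'⟩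
  change synResetVal L (u.1 ++ _) = synResetVal L (v.1 ++ _)
  change residual (u.1 ++ _) L = residual (v.1 ++ _) L at hres'
  rw [synResetVal_concat, synResetVal_concat, hreset, hres']

end HalfIntegralWords

/-! ### Bounds from a region automaton -/

namespace RegionAutomaton

variable {α Q : Type*} {K : ℕ}

theorem next_snd_eq_zero_or (A : RegionAutomaton α Q K) (c : Q × ℝ≥0) (p : ℝ≥0 × α) :
    (A.next c p).2 = 0 ∨ (A.next c p).2 = c.2 + p.1 := by
  simp only [next]
  split_ifs
  · exact Or.inl rfl
  · exact Or.inr rfl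

theorem halfIntegral_conf_snd (A : RegionAutomaton α Q K) (q : Q) (v : HI α) :
    HalfIntegral (A.conf (q, 0) v.1).2 := by
  induction v using HI.induction with
  | nil => exact halfIntegral_zero
  | concat v n a ih =>
    rw [HI.concat, conf_concat]
    rcases A.next_snd_eq_zero_or (A.conf (q, 0) v.1) ((n : ℝ≥0) / 2, a) with h | h
    · rw [h]
      exact halfIntegral_zero
    · rw [h]
      exact ih.add ⟨n, rfl⟩

variable [Finite α] [Finite Q]

theorem synResetVal_lang_le_conf_snd (A : RegionAutomaton α Q K) (q : Q) (w : TimedWord α) :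
    synResetVal (A.lang (q, 0)) w ≤ (A.conf (q, 0) w).2 := by
  induction w using List.reverseRecOn with
  | nil => exact (synResetVal_nil _).le
  | append_singleton w p ih =>
    by_cases hrec : Recognizable (residual (w ++ [p]) (A.lang (q, 0)))
    · exact (synResetVal_of_recognizable hrec).trans_le zero_le
    rw [synResetVal_concat_of_not_recognizable hrec]
    rw [residual_lang, conf_concat] at hrec
    rw [conf_concat]
    rcases A.next_snd_eq_zero_or (A.conf (q, 0) w) p with h | h
    · rw [← Prod.mk.eta (p := A.next _ p), h] at hrec
      exact absurd (A.recognizable_lang_zero _) hrec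
    · rw [h]
      exact add_le_add_left ih p.1

theorem synResetVal_lang_le (A : RegionAutomaton α Q K) (q : Q) (w : TimedWord α) :
    synResetVal (A.lang (q, 0)) w ≤ K := by
  by_contra! h
  refine h.ne_bot (synResetVal_of_recognizable ?_)
  rw [residual_lang]
  exact A.recognizable_lang_of_lt _ (h.trans_le (A.synResetVal_lang_le_conf_snd q w))

theorem synProfile_lang_C (A : RegionAutomaton α Q K) (q : Q) :
    (synProfile (A.lang (q, 0))).C K := by
  intro v a n hn
  change (K : ℝ≥0) < synResetVal (A.lang (q, 0)) v.1 + (n : ℝ≥0) / 2 at hn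
  set c := A.conf (q, 0) v.1
  have hx : (K : ℝ≥0) < c.2 + (n : ℝ≥0) / 2 :=
    hn.trans_le (add_le_add_left (A.synResetVal_lang_le_conf_snd q v.1) _)
  have hy : (K : ℝ≥0) < c.2 + ((2 * K + 1 : ℕ) : ℝ≥0) / 2 :=
    (natCast_lt_natCast_half_iff.2 (Nat.lt_succ_self _)).trans_le le_add_self
  have hres (m : ℕ) : residual (v.concat m a).1 (A.lang (q, 0)) =
      A.lang (A.next c ((m : ℝ≥0) / 2, a)) := by
    rw [residual_lang, HI.concat, conf_concat]
  have hlang : A.lang (A.next c ((n : ℝ≥0) / 2, a)) =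
      A.lang (A.next c (((2 * K + 1 : ℕ) : ℝ≥0) / 2, a)) ∧
      Recognizable (A.lang (A.next c ((n : ℝ≥0) / 2, a))) := by
    simp only [next, A.step_congr c.1 a _ _ (Or.inr ⟨hx, hy⟩)]
    split_ifs
    · exact ⟨rfl, A.recognizable_lang_zero _⟩
    · exact ⟨A.lang_eq_of_lt _ hx hy, A.recognizable_lang_of_lt _ hx⟩
  rw [← hres, ← hres] at hlang
  exact ⟨(synResetVal_of_recognizable hlang.2).trans
    (synResetVal_of_recognizable (hlang.1 ▸ hlang.2)).symm, hlang.1⟩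

theorem finite_canonicalState_lang (A : RegionAutomaton α Q K) (q : Q) :
    Finite (CanonicalState (A.lang (q, 0))) := by
  obtain ⟨r, hr⟩ := exists_fin_eq_iff_regionEqUpTo K
  let code (v : HI α) :=
    (r (synResetVal (A.lang (q, 0)) v.1), (A.conf (q, 0) v.1).1, r (A.conf (q, 0) v.1).2)
  refine Finite.of_injective (fun s : CanonicalState (A.lang (q, 0)) => code s.out)
    fun s s' h => Quotient.out_equiv_out.1 ?_
  obtain ⟨hreset, hstate, hclock⟩ : _ ∧ _ ∧ _ := by simpa only [code, Prod.mk.injEq, hr] using h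
  constructor
  · exact ((HI.halfIntegral_synResetVal _ _).eq_or_lt_of_regionEqUpTo
      (HI.halfIntegral_synResetVal _ _) hreset).resolve_right
        fun h => h.1.not_ge (A.synResetVal_lang_le q _)
  · rw [residual_lang, residual_lang, ← Prod.mk.eta (p := A.conf (q, 0) s.out.1), hstate]
    exact A.lang_congr_of_halfIntegral _ (A.halfIntegral_conf_snd q _)
      (A.halfIntegral_conf_snd q _) hclock

end RegionAutomaton

theorem Recognizable.finite_canonicalState {α : Type*} [Finite α] {L : TimedLanguage α}
    (hL : Recognizable L) : Finite (CanonicalState L) := by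
  obtain ⟨Q, _, K, A, q, rfl⟩ := hL.exists_regionAutomaton
  exact A.finite_canonicalState_lang q

theorem Recognizable.exists_isLeast_synProfile_C {α : Type*} [Finite α] {L : TimedLanguage α}
    (hL : Recognizable L) : ∃ K, IsLeast {k | (synProfile L).C k} K := by
  obtain ⟨Q, _, K, A, q, rfl⟩ := hL.exists_regionAutomaton
  exact ⟨_, isLeast_csInf ⟨K, A.synProfile_lang_C q⟩⟩

theorem Profile.const_eq_of_isLeast {α : Type*} {P : Profile α} {K : ℕ}
    (hK : IsLeast {k | P.C k} K) : P.const = K :=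
  IsLeast.csInf_eq ⟨⟨K, hK.1, rfl⟩, fun _ ⟨_, hk, h⟩ => h ▸ Nat.cast_le.2 (hK.2 hk)⟩

/-! ### The canonical acceptor -/

section CanonicalAcceptor

variable {α : Type*} {L : TimedLanguage α} {K : ℕ}

/-- The transition of the canonical acceptor from the class of `v` to the class of `v (n/2 · a)`;
`K` stands for the constant of the syntactic profile. -/
noncomputable def canonicalTransition (L : TimedLanguage α) (K : ℕ) (v : HI α) (n : ℕ) (a : α) :
    Transition α (CanonicalState L) where
  src := Quotient.mk _ v
  tgt := Quotient.mk _ (v.concat n a)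
  letter := a
  guard := phi K (synResetVal L v.1 + (n : ℝ≥0) / 2)
  reset := decide (synResetVal L (v.concat n a).1 = 0)

theorem canonicalTransition_reset {v : HI α} {n : ℕ} {a : α} :
    (canonicalTransition L K v n a).reset = true ↔ synResetVal L (v.concat n a).1 = 0 :=
  decide_eq_true_iff

theorem mem_canonicalAcceptor_trans (hK : IsLeast {k | (synProfile L).C k} K)
    {θ : Transition α (CanonicalState L)} :
    θ ∈ (canonicalAcceptor L).trans ↔ ∃ v n a, θ = canonicalTransition L K v n a := by
  have hconst := Profile.const_eq_of_isLeast hK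
  constructor
  · rintro ⟨v, v', a, n, hv, rfl⟩
    have htgt : Quotient.mk (synProfile L).rel v' = Quotient.mk _ (v.concat n a) :=
      (Quotient.sound hv).symm
    have hreset : (synProfile L).R.toFun v'.1 = synResetVal L (v.concat n a).1 := hv.1.symm
    refine ⟨v, n, a, ?_⟩
    rw [htgt, hreset, hconst]
    rfl
  · rintro ⟨v, n, a, rfl⟩
    refine ⟨v, v.concat n a, a, n, (synProfile L).rel.iseqv.refl _, ?_⟩
    rw [hconst]
    rfl

theorem synRel_concat_of_regionEqUpTo (hC : (synProfile L).C K) {v v' : HI α}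
    (hv : (synRel L).r v v') {n n' : ℕ}
    (h : RegionEqUpTo K (synResetVal L v.1 + (n : ℝ≥0) / 2)
      (synResetVal L v'.1 + (n' : ℝ≥0) / 2)) (a : α) :
    (synRel L).r (v.concat n a) (v'.concat n' a) := by
  have half (v : HI α) (n : ℕ) : HalfIntegral (synResetVal L v.1 + (n : ℝ≥0) / 2) :=
    (HI.halfIntegral_synResetVal L v).add ⟨n, rfl⟩
  rcases (half v n).eq_or_lt_of_regionEqUpTo (half v' n') h with heq | ⟨hlt, hlt'⟩
  · obtain rfl : n = n' := by
      have hreset : synResetVal L v.1 = synResetVal L v'.1 := hv.1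
      rw [hreset] at heq
      exact_mod_cast (div_left_inj' two_ne_zero).1 (add_left_cancel heq)
    exact synRel_concat hv n a
  · exact (synRel L).trans (hC v a n hlt)
      ((synRel L).trans (synRel_concat hv _ a) ((synRel L).symm (hC v' a n' hlt')))

theorem canonicalTransition_congr (hC : (synProfile L).C K) {v v' : HI α}
    (hv : (synRel L).r v v') {n n' : ℕ}
    (h : RegionEqUpTo K (synResetVal L v.1 + (n : ℝ≥0) / 2)
      (synResetVal L v'.1 + (n' : ℝ≥0) / 2)) (a : α) :
    canonicalTransition L K v n a = canonicalTransition L K v' n' a := by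
  have hconcat := synRel_concat_of_regionEqUpTo hC hv h a
  have hsrc : Quotient.mk (synProfile L).rel v = Quotient.mk _ v' := Quotient.sound hv
  have htgt : Quotient.mk (synProfile L).rel (v.concat n a) = Quotient.mk _ (v'.concat n' a) :=
    Quotient.sound hconcat
  have hreset : synResetVal L (v.concat n a).1 = synResetVal L (v'.concat n' a).1 := hconcat.1
  simp only [canonicalTransition, hsrc, htgt, hreset, phi_congr h]

theorem canonicalAcceptor_deterministic (hK : IsLeast {k | (synProfile L).C k} K) :
    (canonicalAcceptor L).Deterministic := by
  refine OneTA.deterministic_iff.2 ?_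
  rintro q a x _ _ ⟨hθ, hq, ha, hx⟩ ⟨hθ', hq', ha', hx'⟩
  obtain ⟨v, n, _, rfl⟩ := (mem_canonicalAcceptor_trans hK).1 hθ
  obtain ⟨v', n', _, rfl⟩ := (mem_canonicalAcceptor_trans hK).1 hθ'
  obtain rfl := ha
  obtain rfl := ha'
  simp only [canonicalTransition, sat_phi, Set.mem_ofPred_eq] at hx hx'
  exact canonicalTransition_congr hK.1 (Quotient.exact (hq.trans hq'.symm)) (hx.trans hx'.symm) _

theorem canonicalAcceptor_isDTA [Finite α] (hL : Recognizable L)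
    (hK : IsLeast {k | (synProfile L).C k} K) : (canonicalAcceptor L).IsDTA := by
  have := hL.finite_canonicalState
  refine ⟨this, OneTA.finite_trans_of_guard_eq_phi (K := K) fun θ hθ => ?_,
    canonicalAcceptor_deterministic hK⟩
  obtain ⟨v, n, a, rfl⟩ := (mem_canonicalAcceptor_trans hK).1 hθ
  exact ⟨_, rfl⟩

theorem canonicalAcceptor_hasMaxConst (hK : IsLeast {k | (synProfile L).C k} K) :
    (canonicalAcceptor L).HasMaxConst K := by
  refine OneTA.hasMaxConst_of_guard_eq_phi (fun θ hθ => ?_)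
    (fun _ => Nat.le_zero.1 (hK.2 fun _ a => isEmptyElim a)) fun a =>
    ⟨_, (mem_canonicalAcceptor_trans hK).2 ⟨HI.nil, 2 * K + 1, a, rfl⟩, phi_of_lt ?_⟩
  · obtain ⟨v, n, a, rfl⟩ := (mem_canonicalAcceptor_trans hK).1 hθ
    exact ⟨_, rfl⟩
  · exact (natCast_lt_natCast_half_iff.2 (Nat.lt_succ_self _)).trans_le le_add_self

theorem canonicalAcceptor_reaches [Finite α] (hL : Recognizable L)
    (hK : IsLeast {k | (synProfile L).C k} K) (w : TimedWord α) :
    ∃ v : HI α, RegionSimilar L w v.1 ∧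
      (canonicalAcceptor L).Reaches ((canonicalAcceptor L).init, 0) w
        (Quotient.mk _ v, synResetVal L w) := by
  induction w using List.reverseRecOn with
  | nil => exact ⟨HI.nil, .nil hL, OneTA.reaches_nil.2 (by rw [synResetVal_nil]; rfl)⟩
  | append_singleton w p ih =>
    obtain ⟨t, a⟩ := p
    obtain ⟨v, hv, hreach⟩ := ih
    obtain ⟨n, hn⟩ := (HI.halfIntegral_synResetVal L v).exists_regionEq_add hv.1 t
    have hconcat : RegionSimilar L (w ++ [(t, a)]) (v.concat n a).1 := hv.concat hn a
    refine ⟨v.concat n a, hconcat, OneTA.reaches_concat.2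
      ⟨_, canonicalTransition L K v n a, hreach,
        ⟨(mem_canonicalAcceptor_trans hK).2 ⟨v, n, a, rfl⟩, rfl, rfl, ?_⟩, Prod.ext rfl ?_⟩⟩
    · rw [canonicalTransition, sat_phi]
      exact hn.symm.upTo K
    · simp only [canonicalTransition_reset, ← hconcat.1.eq_zero_iff]
      split_ifs with hzero
      · exact hzero
      · exact synResetVal_concat_of_ne_zero hzero

theorem canonicalAcceptor_eq_of_reaches [Finite α] (hL : Recognizable L)
    (hK : IsLeast {k | (synProfile L).C k} K) {w : TimedWord α} {c : CanonicalState L × ℝ≥0}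
    (h : (canonicalAcceptor L).Reaches ((canonicalAcceptor L).init, 0) w c) :
    ∃ v : HI α, RegionSimilar L w v.1 ∧ c = (Quotient.mk _ v, synResetVal L w) := by
  obtain ⟨v, hv, hreach⟩ := canonicalAcceptor_reaches hL hK w
  exact ⟨v, hv, (canonicalAcceptor_deterministic hK).reaches_unique h hreach⟩

theorem canonicalAcceptor_complete [Finite α] (hL : Recognizable L)
    (hK : IsLeast {k | (synProfile L).C k} K) : (canonicalAcceptor L).Complete :=
  (canonicalAcceptor_deterministic hK).complete fun w =>
    let ⟨_, _, hreach⟩ := canonicalAcceptor_reaches hL hK w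
    ⟨_, hreach⟩

theorem canonicalAcceptor_hasResetFunction [Finite α] (hL : Recognizable L)
    (hK : IsLeast {k | (synProfile L).C k} K) :
    (canonicalAcceptor L).HasResetFunction (synReset L).toFun := fun w =>
  let ⟨_, _, hreach⟩ := canonicalAcceptor_reaches hL hK w
  ⟨_, hreach⟩

theorem mk_mem_canonicalAcceptor_accept {v : HI α} :
    Quotient.mk _ v ∈ (canonicalAcceptor L).accept ↔ v.1 ∈ L := by
  refine ⟨fun ⟨v', hv', h⟩ => ?_, fun h => ⟨v, h, rfl⟩⟩
  have hres : residual v.1 L = residual v'.1 L := (Quotient.exact h).2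
  rw [mem_iff_nil_mem_residual] at hv' ⊢
  rwa [hres]

theorem canonicalAcceptor_language [Finite α] (hL : Recognizable L)
    (hK : IsLeast {k | (synProfile L).C k} K) : (canonicalAcceptor L).language = L := by
  ext w
  constructor
  · rintro ⟨q, ν, hq, h⟩
    obtain ⟨v, hv, ⟨⟩⟩ := canonicalAcceptor_eq_of_reaches hL hK h
    exact hv.mem_iff.2 (mk_mem_canonicalAcceptor_accept.1 hq)
  · intro hw
    obtain ⟨v, hv, h⟩ := canonicalAcceptor_reaches hL hK w
    exact ⟨_, _, mk_mem_canonicalAcceptor_accept.2 (hv.mem_iff.1 hw), h⟩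

theorem languageConst_eq_of_isLeast [Finite α] (hL : Recognizable L)
    (hK : IsLeast {k | (synProfile L).C k} K) : languageConst L = K := by
  have hmax := canonicalAcceptor_hasMaxConst hK
  have hDTA := canonicalAcceptor_isDTA hL hK
  have := hDTA.finite_states
  refine IsLeast.csInf_eq ⟨?_, ?_⟩
  · obtain ⟨Q, B, hB, hBK, hlang⟩ := ((canonicalAcceptor L).toRegionAutomaton
      fun _ => hmax.maxConst_le).exists_isDTA_language_eq (some (canonicalAcceptor L).init)
    refine ⟨Q, B, hB, hBK fun _ => Nat.le_zero.1 (hK.2 fun _ a => isEmptyElim a), ?_⟩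
    rw [hlang, hDTA.deterministic.lang_toRegionAutomaton, canonicalAcceptor_language hL hK]
  · rintro K' ⟨Q, B, hB, hBK, hlang⟩
    have := hB.finite_states
    refine hK.2 ?_
    rw [← hlang, ← hB.deterministic.lang_toRegionAutomaton fun _ => hBK.maxConst_le]
    exact RegionAutomaton.synProfile_lang_C _ _

/-- The region of a state `[v]` of the canonical acceptor, namely the `K`-region of `R^L(v)`. -/
def canonicalRegion (L : TimedLanguage α) (K : ℕ) : CanonicalState L → Set ℝ≥0 :=
  Quotient.lift (fun v => {z | RegionEqUpTo K (synResetVal L v.1) z}) fun v v' h => by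
    have hreset : synResetVal L v.1 = synResetVal L v'.1 := h.1
    rw [hreset]

theorem canonicalRegion_mk (v : HI α) :
    canonicalRegion L K (Quotient.mk _ v) = {z | RegionEqUpTo K (synResetVal L v.1) z} := rfl

theorem canonicalAcceptor_isRegionAssignment [Finite α] (hL : Recognizable L)
    (hK : IsLeast {k | (synProfile L).C k} K) :
    (canonicalAcceptor L).IsRegionAssignment K (canonicalRegion L K) := by
  refine ⟨fun q => q.inductionOn fun v => ⟨_, rfl⟩, fun w q ν h => ?_⟩
  obtain ⟨v, hv, ⟨⟩⟩ := canonicalAcceptor_eq_of_reaches hL hK h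
  exact hv.1.symm.upTo K

theorem canonicalAcceptor_isSyntacticRegionAssignment
    (hK : IsLeast {k | (synProfile L).C k} K) :
    (canonicalAcceptor L).IsSyntacticRegionAssignment (canonicalRegion L K) := by
  refine fun q => ⟨?_, fun hno θ hθ htgt => ?_⟩
  · rintro ⟨θ, hθ, rfl, hreset⟩
    obtain ⟨v, n, a, rfl⟩ := (mem_canonicalAcceptor_trans hK).1 hθ
    rw [canonicalTransition_reset] at hreset
    refine ⟨fun θ' hθ' htgt => ?_, ?_⟩
    · obtain ⟨v', n', a', rfl⟩ := (mem_canonicalAcceptor_trans hK).1 hθ'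
      have hreset' : synResetVal L (v'.concat n' a').1 = synResetVal L (v.concat n a).1 :=
        (Quotient.exact htgt).1
      rw [canonicalTransition_reset, hreset', hreset]
    · rw [canonicalTransition, canonicalRegion_mk, hreset, ← Nat.cast_zero,
        setOf_regionEqUpTo_natCast (Nat.zero_le K)]
  · obtain ⟨v, n, a, rfl⟩ := (mem_canonicalAcceptor_trans hK).1 hθ
    subst htgt
    have hne : synResetVal L (v.concat n a).1 ≠ 0 := fun h =>
      hno ⟨_, hθ, rfl, canonicalTransition_reset.2 h⟩
    rw [canonicalTransition, canonicalRegion_mk, sat_phi, HI.concat,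
      synResetVal_concat_of_ne_zero hne]

theorem canonicalAcceptor_isAcceptor [Finite α] (hL : Recognizable L)
    (hK : IsLeast {k | (synProfile L).C k} K) : (canonicalAcceptor L).IsAcceptor K where
  isDTA := canonicalAcceptor_isDTA hL hK
  complete := canonicalAcceptor_complete hL hK
  maxConst := canonicalAcceptor_hasMaxConst hK
  guard_region θ hθ := by
    obtain ⟨v, n, a, rfl⟩ := (mem_canonicalAcceptor_trans hK).1 hθ
    exact ⟨_, sat_phi _ _⟩
  region := ⟨_, canonicalAcceptor_isRegionAssignment hL hK⟩

theorem canonicalAcceptor_isStrictAcceptor [Finite α] (hL : Recognizable L)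
    (hK : IsLeast {k | (synProfile L).C k} K) :
    (canonicalAcceptor L).IsStrictAcceptor K where
  isAcceptor := canonicalAcceptor_isAcceptor hL hK
  strict θ hθ m hm := by
    obtain ⟨v, n, a, rfl⟩ := (mem_canonicalAcceptor_trans hK).1 hθ
    have hguard : synResetVal L v.1 + (n : ℝ≥0) / 2 = m := by
      rw [← Set.mem_singleton_iff, ← hm]
      exact self_mem_sat_phi K _
    rw [canonicalTransition_reset]
    by_contra hne
    exact hne <| synResetVal_eq_zero_of_eq_natCast hL <|
      (synResetVal_concat_of_ne_zero hne).trans hguard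

end CanonicalAcceptor

/-! ### Minimality -/

namespace OneTA

variable {α Q : Type*} {B : OneTA α Q} {K : ℕ} {w : TimedWord α} {v v' : HI α} {c c' : Q × ℝ≥0}

theorem Reaches.halfIntegral (h : B.Reaches (B.init, 0) v.1 c) : HalfIntegral c.2 := by
  induction v using HI.induction generalizing c with
  | nil =>
    rw [reaches_nil.1 h]
    exact halfIntegral_zero
  | concat v n a ih =>
    obtain ⟨d, θ, hd, -, rfl⟩ := reaches_concat.1 h
    dsimp only
    split_ifs
    · exact halfIntegral_zero
    · exact (ih hd).add ⟨n, rfl⟩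

theorem Deterministic.residual_language (hB : B.Deterministic)
    (hK : ∀ θ ∈ B.trans, θ.guard.maxConst ≤ K) (h : B.Reaches (B.init, 0) w c) :
    residual w B.language = (B.toRegionAutomaton hK).lang (some c.1, c.2) := by
  rw [← hB.lang_toRegionAutomaton hK, RegionAutomaton.residual_lang,
    (hB.toRegionAutomaton_conf_eq_iff hK).2 h]

theorem IsDTA.recognizable_residual_of_lt [Finite α] (hB : B.IsDTA) (hK : B.HasMaxConst K)
    (h : B.Reaches (B.init, 0) w c) (hc : (K : ℝ≥0) < c.2) :
    Recognizable (residual w B.language) := by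
  have := hB.finite_states
  rw [hB.deterministic.residual_language (fun _ => hK.maxConst_le) h]
  exact RegionAutomaton.recognizable_lang_of_lt _ _ hc

theorem IsDTA.recognizable_residual_of_eq_natCast [Finite α] (hB : B.IsDTA)
    (h : B.Reaches (B.init, 0) w c) {n : ℕ} (hc : c.2 = n) :
    Recognizable (residual w B.language) := by
  obtain ⟨K, hK⟩ := hB.exists_hasMaxConst
  have := hB.finite_states
  rw [hB.deterministic.residual_language (fun _ => hK.maxConst_le) h, hc]
  exact RegionAutomaton.recognizable_lang_natCast _ _ _

theorem IsStrictAcceptor.clock_eq_zero_or_lt (hB : B.IsStrictAcceptor K)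
    (h : B.Reaches (B.init, 0) w c) {n : ℕ} (hc : c.2 = n) : c.2 = 0 ∨ (K : ℝ≥0) < c.2 := by
  cases w using List.reverseRecOn with
  | nil => exact Or.inl (by rw [reaches_nil.1 h])
  | append_singleton w p =>
    obtain ⟨d, θ, -, ⟨hθ, -, -, hguard⟩, rfl⟩ := reaches_concat.1 h
    dsimp only at hc ⊢
    split_ifs at hc ⊢ with hreset
    · exact Or.inl rfl
    · rw [hc] at hguard ⊢
      by_contra! hle
      refine hreset (hB.strict θ hθ n ?_)
      rw [(hB.isAcceptor.guard_region θ hθ).eq_setOf_regionEqUpTo hguard,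
        setOf_regionEqUpTo_natCast (Nat.cast_le.1 hle.2)]

theorem IsStrictAcceptor.clock_eq_synResetVal [Finite α] (hB : B.IsStrictAcceptor K)
    (h : B.Reaches (B.init, 0) v.1 c) (hrec : ¬ Recognizable (residual v.1 B.language)) :
    c.2 = synResetVal B.language v.1 := by
  have hDTA := hB.isAcceptor.isDTA
  induction v using HI.induction generalizing c with
  | nil => exact absurd hDTA.recognizable hrec
  | concat v n a ih =>
    have hnat (m : ℕ) : c.2 ≠ m := fun hm =>
      hrec (hDTA.recognizable_residual_of_eq_natCast h hm)
    have hlt : ¬ (K : ℝ≥0) < c.2 := fun hc =>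
      hrec (hDTA.recognizable_residual_of_lt hB.isAcceptor.maxConst h hc)
    have hsyn : synResetVal B.language (v.concat n a).1 =
        synResetVal B.language v.1 + (n : ℝ≥0) / 2 :=
      synResetVal_concat_of_not_recognizable hrec
    obtain ⟨d, θ, hd, -, hc⟩ := reaches_concat.1 h
    have hclock : c.2 = d.2 + (n : ℝ≥0) / 2 := by
      rw [hc]
      refine if_neg fun hreset => hnat 0 ?_
      rw [hc, Nat.cast_zero]
      exact if_pos hreset
    rw [hclock, hsyn]
    congr 1
    by_cases hrec' : Recognizable (residual v.1 B.language)
    · rw [synResetVal_of_recognizable hrec'] at hsyn ⊢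
      have hdelay (m : ℕ) : (n : ℝ≥0) / 2 ≠ m := fun hm =>
        hrec <| recognizable_residual_of_synResetVal_eq_natCast hDTA.recognizable
          (hsyn.trans ((zero_add _).trans hm))
      obtain ⟨m, hm⟩ := hd.halfIntegral.exists_eq_natCast_of_add ⟨n, rfl⟩ hdelay
        fun m => hclock ▸ hnat m
      exact (hB.clock_eq_zero_or_lt hd hm).resolve_right fun hK =>
        hlt (hclock ▸ hK.trans_le le_self_add)
    · exact ih hd hrec'

theorem IsStrictAcceptor.synRel_of_reaches [Finite α] (hB : B.IsStrictAcceptor K)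
    (h : B.Reaches (B.init, 0) v.1 c) (h' : B.Reaches (B.init, 0) v'.1 c') (hq : c.1 = c'.1) :
    (synRel B.language).r v v' := by
  have hDTA := hB.isAcceptor.isDTA
  have hmax := hB.isAcceptor.maxConst
  obtain ⟨region, hregion, hmem⟩ := hB.isAcceptor.region
  have hclock : RegionEqUpTo K c.2 c'.2 :=
    (hregion c.1).regionEqUpTo (hmem _ _ _ h) (hq ▸ hmem _ _ _ h')
  have hres : residual v.1 B.language = residual v'.1 B.language := by
    rw [hDTA.deterministic.residual_language (fun _ => hmax.maxConst_le) h,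
      hDTA.deterministic.residual_language (fun _ => hmax.maxConst_le) h', hq]
    exact RegionAutomaton.lang_congr_of_halfIntegral _ _ h.halfIntegral h'.halfIntegral hclock
  refine ⟨?_, hres⟩
  change synResetVal B.language v.1 = synResetVal B.language v'.1
  by_cases hrec : Recognizable (residual v.1 B.language)
  · rw [synResetVal_of_recognizable hrec, synResetVal_of_recognizable (hres ▸ hrec)]
  · rw [← hB.clock_eq_synResetVal h hrec, ← hB.clock_eq_synResetVal h' (hres ▸ hrec)]
    exact (h.halfIntegral.eq_or_lt_of_regionEqUpTo h'.halfIntegral hclock).resolve_right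
      fun hlt => hrec (hDTA.recognizable_residual_of_lt hmax h hlt.1)

theorem IsStrictAcceptor.card_canonicalState_le [Finite α] (hB : B.IsStrictAcceptor K) :
    Nat.card (CanonicalState B.language) ≤ Nat.card Q := by
  have := hB.isAcceptor.isDTA.finite_states
  choose c hc using fun s : CanonicalState B.language =>
    hB.isAcceptor.complete.exists_reaches s.out.1
  exact Nat.card_le_card_of_injective (fun s => (c s).1) fun s s' h =>
    Quotient.out_equiv_out.1 (hB.synRel_of_reaches (hc s) (hc s') h)

end OneTA

end OneClock

theorem mainTheorem5 {α : Type*} [Finite α] (L : OneClock.TimedLanguage α)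
    (hL : OneClock.Recognizable L) :
    ((OneClock.canonicalAcceptor L).IsStrictAcceptor (OneClock.languageConst L) ∧
      (∃ region : OneClock.CanonicalState L → Set NNReal,
        (OneClock.canonicalAcceptor L).IsRegionAssignment (OneClock.languageConst L) region ∧
        (OneClock.canonicalAcceptor L).IsSyntacticRegionAssignment region) ∧
      (OneClock.canonicalAcceptor L).language = L ∧
      (OneClock.canonicalAcceptor L).HasResetFunction (OneClock.synReset L).toFun) ∧
    ∀ (Q : Type*) (B : OneClock.OneTA α Q) (K : ℕ),
      B.IsStrictAcceptor K → B.language = L →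
        Nat.card (OneClock.CanonicalState L) ≤ Nat.card Q := by
  obtain ⟨K, hK⟩ := hL.exists_isLeast_synProfile_C
  rw [OneClock.languageConst_eq_of_isLeast hL hK]
  refine ⟨⟨OneClock.canonicalAcceptor_isStrictAcceptor hL hK,
    ⟨_, OneClock.canonicalAcceptor_isRegionAssignment hL hK,
      OneClock.canonicalAcceptor_isSyntacticRegionAssignment hK⟩,
    OneClock.canonicalAcceptor_language hL hK,
    OneClock.canonicalAcceptor_hasResetFunction hL hK⟩, ?_⟩
  rintro Q B K' hB rfl
  exact hB.card_canonicalState_le
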